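/- Let $\mathbb{K}$ be an infinite field, $G$ any group, and $g\in G$ with $g\neq 1$. Let $\mathrm{UT}_n^{(-)}$ be the Lie algebra of upper triangular $n\times n$ matrices over $\mathbb{K}$ with bracket $[a,b]=ab-ba$. Let $\Gamma(g,1)$ be the $G$-grading on $\mathrm{UT}_3^{(-)}$ in which the matrix units are homogeneous with $\deg e_{11}=\deg e_{22}=\deg e_{33}=\deg e_{23}=1$ and $\deg e_{12}=\deg e_{13}=g$. Let $\mathcal{L}(X^G)$ be the free Lie algebra over $\mathbb{K}$ in the variables $x_{i,h}$ ($i\in\mathbb{N}$, $h\in G$), $x_{i,h}$ having degree $h$, and write $y_i=x_{i,1}$, $z_i=x_{i,g}$, $Y=\{y_i\mid i\in\mathbb{N}\}$. Let $\mathrm{Id}_G(\mathrm{UT}_3^{(-)},\Gamma(g,1))$ be the ideal of all $f\in\mathcal{L}(X^G)$ that vanish under every substitution of the variables $x_{i,h}$ by elements of degree $h$ of $\mathrm{UT}_3^{(-)}$. A $T_G$-ideal is an ideal of $\mathcal{L}(X^G)$ stable under all substitutions of the variables $x_{i,h}$ by linear combinations of Lie monomials of degree $h$. Commutators are left-normed,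 $[a,b,c]=[[a,b],c]$, and $[a,b^{(k)}]=[a,b,\ldots,b]$ with $k$ entries $b$. (1) $\mathrm{Id}_G(\mathrm{UT}_3^{(-)},\Gamma(g,1))$ is generated, as a $T_G$-ideal, by $$x_{1,l}\ \ (l\in G\setminus\{1,g\}),\qquad [z_1,z_2],\qquad [[y_1,y_2],[y_3,y_4]],\qquad [z_1,[y_2,y_3],[y_4,y_5]].$$ (2) Let $\mathcal{B}\subseteq\mathcal{L}(Y)$ be any set of polynomials, each homogeneous with respect to length, whose images form a basis of the relatively free algebra $\mathcal{L}(Y)/\mathrm{Id}(\mathrm{UT}_2^{(-)})$, where $\mathrm{Id}(\mathrm{UT}_2^{(-)})$ is the ideal of ordinary polynomial identities of $\mathrm{UT}_2^{(-)}$ in the variables $Y$. Then the images of the following elements are pairwise distinct and form a basis of the relatively free algebra $\mathcal{L}(X^G)/\mathrm{Id}_G(\mathrm{UT}_3^{(-)},\Gamma(g,1))$: * the elements of $\mathcal{B}$; * the commutators of type 1, $[z_j,y_{i_1}^{(k_1)},\ldots,y_{i_n}^{(k_n)}]$; * the commutators of type 2, $[m,z_j,y_{i_1}^{(k_1)},\ldots,y_{i_n}^{(k_n)}]$,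 where $m\in\mathcal{B}$ has length at least $2$; where in both cases $j\in\mathbb{N}$, $n\ge 0$, $i_1<\cdots<i_n$ and $k_1,\ldots,k_n\geq 1$. -/

import Mathlib

/-! Graded polynomial identities of upper triangular matrices viewed as Lie algebras. -/

section UpperTriangular

attribute [local instance 100] LieRing.ofAssociativeRing

/-- The Lie algebra of upper triangular `n × n` matrices over `K`, with the commutator bracket. -/
def UT (n : ℕ) (K : Type*) [Field K] : LieSubalgebra K (Matrix (Fin n) (Fin n) K) where
  carrier := {A | ∀ i j, j < i → A i j = 0}
  zero_mem' := fun _ _ _ => rfl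
  add_mem' := by
    intro A B hA hB i j hij
    simp [hA i j hij, hB i j hij]
  smul_mem' := by
    intro c A hA i j hij
    simp [hA i j hij]
  lie_mem' := by
    intro A B hA hB i j hij
    have key : ∀ A B : Matrix (Fin n) (Fin n) K, (∀ i j, j < i → A i j = 0) →
        (∀ i j, j < i → B i j = 0) → (A * B) i j = 0 := by
      intro A B hA hB
      rw [Matrix.mul_apply]
      refine Finset.sum_eq_zero fun k _ => ?_
      rcases lt_or_ge k i with h | h
      · rw [hA i k h, zero_mul]
      · rw [hB k j (lt_of_lt_of_le hij h), mul_zero]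
    rw [Ring.lie_def, Matrix.sub_apply, key A B hA hB, key B A hB hA, sub_zero]

/-- The degree of the matrix unit `e_{ij}`, `i ≤ j`, of `3 × 3` upper triangular matrices in the
elementary grading `Γ(g, h)`: `deg e_{ii} = 1`, `deg e_{12} = g`, `deg e_{23} = h`,
`deg e_{13} = g h`. The entries below the diagonal are never used. -/
def unitDegree {G : Type*} [Group G] (g h : G) (i j : Fin 3) : G :=
  !![1, g, g * h;
     1, 1, h;
     1, 1, 1] i j

/-- The elementary grading `Γ(g, h)`: its component of degree `k` consists of the upper
triangular matrices that are linear combinations of the units `e_{ij}` of degree `k`. -/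
def elementaryGrading (K : Type*) [Field K] {G : Type*} [Group G] (g h : G) (k : G) :
    Submodule K (UT 3 K) where
  carrier := {A | ∀ i j, i ≤ j → unitDegree g h i j ≠ k → A.1 i j = 0}
  zero_mem' := fun _ _ _ _ => rfl
  add_mem' := by
    intro A B hA hB i j hij hk
    simp [hA i j hij hk, hB i j hij hk]
  smul_mem' := by
    intro c A hA i j hij hk
    simp [hA i j hij hk]

end UpperTriangular

section Identities

/-- The ideal `Id(A)` of ordinary polynomial identities of a Lie algebra `A`, in the free Lie
algebra in the variables `y_i`, `i ∈ ℕ`: the polynomials that vanish under every evaluation. -/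
noncomputable def identities (K A : Type*) [Field K] [LieRing A] [LieAlgebra K A] :
    LieIdeal K (FreeLieAlgebra K ℕ) :=
  ⨅ φ : FreeLieAlgebra K ℕ →ₗ⁅K⁆ A, φ.ker

/-- The variable `x_{i,h}` of degree `h` of the free Lie algebra in the variables
`X^G = {x_{i,h} | i ∈ ℕ, h ∈ G}`. -/
noncomputable def gradedVar (K : Type*) [Field K] {G : Type*} (i : ℕ) (h : G) :
    FreeLieAlgebra K (ℕ × G) :=
  FreeLieAlgebra.of K (i, h)

/-- `IsMonomialOfDegree K h a`: `a` is a Lie monomial in the variables `X^G`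
(with any arrangement of brackets) of `G`-degree `h`. -/
inductive IsMonomialOfDegree (K : Type*) [Field K] {G : Type*} [Group G] :
    G → FreeLieAlgebra K (ℕ × G) → Prop
  | of_var (i : ℕ) (h : G) : IsMonomialOfDegree K h (gradedVar K i h)
  | of_lie (h k : G) (a b : FreeLieAlgebra K (ℕ × G)) :
      IsMonomialOfDegree K h a → IsMonomialOfDegree K k b → IsMonomialOfDegree K (h * k) ⁅a, b⁆

/-- The homogeneous component of degree `h` of the free Lie algebra on `X^G`. -/
noncomputable def freeComponent (K : Type*) [Field K] {G : Type*} [Group G] (h : G) :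
    Submodule K (FreeLieAlgebra K (ℕ × G)) :=
  Submodule.span K {a | IsMonomialOfDegree K h a}

/-- The ideal `Id_G(A)` of graded polynomial identities of a Lie algebra `A` with grading
`A = ⨁ 𝒜 h`: the polynomials that vanish under every evaluation which sends each variable
`x_{i,h}` to an element of `𝒜 h`. -/
noncomputable def gradedIdentities {K A G : Type*} [Field K] [LieRing A] [LieAlgebra K A]
    (𝒜 : G → Submodule K A) : LieIdeal K (FreeLieAlgebra K (ℕ × G)) :=
  ⨅ φ : {φ : FreeLieAlgebra K (ℕ × G) →ₗ⁅K⁆ A // ∀ i h, φ (gradedVar K i h) ∈ 𝒜 h}, φ.1.ker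

/-- A `T_G`-ideal: an ideal of the free Lie algebra on `X^G` which is stable under all graded
endomorphisms, i.e. all substitutions of the `x_{i,h}` by homogeneous polynomials of degree `h`. -/
def IsTGIdeal {K G : Type*} [Field K] [Group G] (I : LieIdeal K (FreeLieAlgebra K (ℕ × G))) :
    Prop :=
  ∀ φ : FreeLieAlgebra K (ℕ × G) →ₗ⁅K⁆ FreeLieAlgebra K (ℕ × G),
    (∀ i h, φ (gradedVar K i h) ∈ freeComponent K h) → ∀ f ∈ I, φ f ∈ I

/-- The `T_G`-ideal generated by a set of polynomials. -/
noncomputable def tgIdealSpan {K G : Type*} [Field K] [Group G] (S : Set (FreeLieAlgebra K (ℕ × G))) :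
    LieIdeal K (FreeLieAlgebra K (ℕ × G)) :=
  sInf {I | IsTGIdeal I ∧ ∀ f ∈ S, f ∈ I}

/-- The family `v` of elements of `L` is a basis of the quotient algebra `L / I`. -/
def IsBasisModulo {K L ι : Type*} [Field K] [LieRing L] [LieAlgebra K L] (I : LieIdeal K L)
    (v : ι → L) : Prop :=
  LinearIndependent K (fun i => (LieSubmodule.Quotient.mk (v i) : L ⧸ I)) ∧
    Submodule.span K (Set.range fun i => (LieSubmodule.Quotient.mk (v i) : L ⧸ I)) = ⊤

end Identities

section Commutators

/-- `IsMonomialOfLength K n a`: `a` is a Lie monomial of length `n` in the variables `y_i`. -/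
inductive IsMonomialOfLength (K : Type*) [Field K] : ℕ → FreeLieAlgebra K ℕ → Prop
  | of_var (i : ℕ) : IsMonomialOfLength K 1 (FreeLieAlgebra.of K i)
  | of_lie (m n : ℕ) (a b : FreeLieAlgebra K ℕ) :
      IsMonomialOfLength K m a → IsMonomialOfLength K n b → IsMonomialOfLength K (m + n) ⁅a, b⁆

/-- The polynomials in the variables `y_i` that are homogeneous of length `n`. -/
noncomputable def lengthComponent (K : Type*) [Field K] (n : ℕ) : Submodule K (FreeLieAlgebra K ℕ) :=
  Submodule.span K {a | IsMonomialOfLength K n a}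

/-- The embedding of the free Lie algebra in the variables `Y` into the one in the variables
`X^G`, with `y_i = x_{i,1}`. -/
noncomputable def inclY (K G : Type*) [Field K] [Group G] :
    FreeLieAlgebra K ℕ →ₗ⁅K⁆ FreeLieAlgebra K (ℕ × G) :=
  FreeLieAlgebra.lift K fun i => gradedVar K i (1 : G)

/-- `[x, y^{(m)}] = [x, y, …, y]`, left-normed, with `m` entries `y`. -/
def lieIter {L : Type*} [LieRing L] (x y : L) (m : ℕ) : L :=
  (fun a => ⁅a, y⁆)^[m] x

/-- The left-normed commutator `[a, y_{i_1}^{(k_1)}, …, y_{i_n}^{(k_n)}]`, where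
`i_1 < ⋯ < i_n` are the elements of the support of `k` and `k_j = k i_j`. -/
noncomputable def lieTail {K G : Type*} [Field K] [Group G] (a : FreeLieAlgebra K (ℕ × G))
    (k : ℕ →₀ ℕ) : FreeLieAlgebra K (ℕ × G) :=
  (k.support.sort (· ≤ ·)).foldl (fun b i => lieIter b (gradedVar K i (1 : G)) (k i)) a

/-- The commutators of type 1, `[z_j, y_{i_1}^{(k_1)}, …, y_{i_n}^{(k_n)}]`, `z_j = x_{j,g}`. -/
noncomputable def typeOne (K : Type*) [Field K] {G : Type*} [Group G] (g : G)
    (p : ℕ × (ℕ →₀ ℕ)) : FreeLieAlgebra K (ℕ × G) :=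
  lieTail (gradedVar K p.1 g) p.2

/-- The commutators of type 2, `[m, z_j, y_{i_1}^{(q_1)}, …, y_{i_n}^{(q_n)}]`, where
`m ∈ B` has length at least two. -/
noncomputable def typeTwo {K : Type*} [Field K] {G : Type*} [Group G] (g : G)
    (B : Set (FreeLieAlgebra K ℕ))
    (p : {m // m ∈ B ∧ ∃ n, 2 ≤ n ∧ m ∈ lengthComponent K n} × ℕ × (ℕ →₀ ℕ)) :
    FreeLieAlgebra K (ℕ × G) :=
  lieTail ⁅inclY K G p.1.1, gradedVar K p.2.1 g⁆ p.2.2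

end Commutators

/-! Let I be the T_G-ideal generated by the listed polynomials. In UT_3 the component of degree 1 is
the diagonal plus K e_23 and the component of degree g is the abelian span of e_12 and e_13; hence I
⊆ Id_G (`tgIdealSpan_gradedGenerators_le`). The proof shows that the proposed family spans modulo
the smaller ideal I (`mem_span_family_sup`) and is independent modulo the larger ideal Id_G
(`linearIndependent_family`). An element of Id_G is then, modulo I, a combination of the family
lying in Id_G, hence zero. So Id_G = I, and the family is a basis.

Spanning: the operators [·, y_i] commute up to brackets with elements of the derived algebra of
L(Y). Applied to a commutator of type 2 such brackets fall into I; applied to one of type 1 they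
give type 2. So tails can be sorted, first for type 2 and then for type 1, and elements of degree g
commute modulo I. Reducing L(Y) to B needs Id(UT_2) ⊆ I, which holds because over an infinite field
the metabelian law implies all identities of UT_2 (`identities_le_of_lie_lie_mem`).

Independence: put y_i ↦ χ(y_i) in the lower right block, with χ : L(Y) → UT_2, and z_j ↦ p_j e_12.
Setting z = 0 isolates B. The e_12 entry kills type 2 and turns type 1 into p_j times a monomial in
the first diagonal entries of the χ(y_i). The e_13 entry of a type 2 commutator is, up to sign,
χ(m)_12 p_j times a monomial in the second diagonal entries. Adding scalar matrices to the χ(y_i)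
makes the latter independent of χ(m)_12, and over an infinite field distinct monomials are
independent functions. -/

section FreeLieAlgebra

/-! ### Induction principles for free Lie algebras. -/

/-- A property of elements of a free Lie algebra that holds for the generators and is stable under
the Lie algebra operations holds everywhere. -/
theorem FreeLieAlgebra.mem_of_forall_of_mem {K X : Type*} [CommRing K]
    (S : LieSubalgebra K (FreeLieAlgebra K X)) (h : ∀ x, FreeLieAlgebra.of K x ∈ S)
    (a : FreeLieAlgebra K X) : a ∈ S := by
  let f : FreeLieAlgebra K X →ₗ⁅K⁆ S := FreeLieAlgebra.lift K fun x => ⟨_, h x⟩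
  have hf : S.incl.comp f = LieHom.id := FreeLieAlgebra.hom_ext fun x => by simp [f]
  have := LieHom.congr_fun hf a
  simp only [LieHom.comp_apply, LieHom.id_apply] at this
  rw [← this]
  exact (f a).2

/-- A subspace of a free Lie algebra that contains the generators and is stable under brackets with
the generators is everything. -/
theorem FreeLieAlgebra.mem_of_forall_lie_of_mem {K X : Type*} [CommRing K]
    (S : Submodule K (FreeLieAlgebra K X)) (h : ∀ x, FreeLieAlgebra.of K x ∈ S)
    (hS : ∀ a ∈ S, ∀ x, ⁅a, FreeLieAlgebra.of K x⁆ ∈ S)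
    (a : FreeLieAlgebra K X) : a ∈ S := by
  -- The elements b with [S, b] ⊆ S form a subalgebra by the Jacobi identity. It contains the
  -- generators, so it is everything, and S is itself a subalgebra.
  let N : LieSubalgebra K (FreeLieAlgebra K X) :=
    { carrier := {b | ∀ a ∈ S, ⁅a, b⁆ ∈ S}
      zero_mem' := fun a _ => by simp
      add_mem' := fun {b c} hb hc a ha => by
        rw [lie_add]; exact S.add_mem (hb a ha) (hc a ha)
      smul_mem' := fun r b hb a ha => by
        rw [lie_smul]; exact S.smul_mem r (hb a ha)
      lie_mem' := fun {b c} hb hc a ha => by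
        rw [leibniz_lie, ← lie_skew b]
        exact S.add_mem (hc _ (hb a ha)) (S.neg_mem (hb _ (hc a ha))) }
  have hN : ∀ b, b ∈ N := FreeLieAlgebra.mem_of_forall_of_mem N fun x a ha => hS a ha x
  let S' : LieSubalgebra K (FreeLieAlgebra K X) :=
    { S with lie_mem' := fun {a b} ha _ => hN b a ha }
  exact FreeLieAlgebra.mem_of_forall_of_mem S' h a

end FreeLieAlgebra

/-! ### Left-normed commutators and reordering of their entries. -/

section LieWord

variable {K L : Type*} [CommRing K] [LieRing L] [LieAlgebra K L]

/-- The left-normed commutator `[w, y_{i_1}, …, y_{i_n}]`. -/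
def lieWord (y : ℕ → L) (w : L) (l : List ℕ) : L :=
  l.foldl (fun b i => ⁅b, y i⁆) w

@[simp] theorem lieWord_nil (y : ℕ → L) (w : L) : lieWord y w [] = w := rfl

theorem lieWord_cons (y : ℕ → L) (w : L) (i : ℕ) (l : List ℕ) :
    lieWord y w (i :: l) = lieWord y ⁅w, y i⁆ l := rfl

theorem lieWord_concat (y : ℕ → L) (w : L) (i : ℕ) (l : List ℕ) :
    lieWord y w (l ++ [i]) = ⁅lieWord y w l, y i⁆ := by
  simp [lieWord]

theorem lieWord_sub (y : ℕ → L) (v w : L) (l : List ℕ) :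
    lieWord y (v - w) l = lieWord y v l - lieWord y w l := by
  induction l generalizing v w with
  | nil => rfl
  | cons i l ih => simp [lieWord_cons, ih]

theorem lieWord_neg (y : ℕ → L) (w : L) (l : List ℕ) :
    lieWord y (-w) l = -lieWord y w l := by
  induction l generalizing w with
  | nil => rfl
  | cons i l ih => rw [lieWord_cons, neg_lie, ih, lieWord_cons]

theorem lieWord_zero (y : ℕ → L) (l : List ℕ) : lieWord y 0 l = 0 := by
  induction l with
  | nil => rfl
  | cons i l ih => simp [lieWord_cons, ih]

theorem lieWord_mem {C : Set L} {y : ℕ → L} (hC : ∀ w ∈ C, ∀ i, ⁅w, y i⁆ ∈ C) {w : L} (hw : w ∈ C)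
    (l : List ℕ) : lieWord y w l ∈ C := by
  induction l generalizing w with
  | nil => exact hw
  | cons i l ih => exact ih (hC w hw i)

theorem map_lieWord {L' : Type*} [LieRing L'] [LieAlgebra K L'] (f : L →ₗ⁅K⁆ L') (y : ℕ → L)
    (w : L) (l : List ℕ) : f (lieWord y w l) = lieWord (fun i => f (y i)) (f w) l := by
  induction l generalizing w with
  | nil => rfl
  | cons i l ih => simp [lieWord_cons, ih]

/-- Modulo a subspace `P`, a left-normed commutator does not depend on the order of the entries
`y_i` if the operators `[·, y_i]` preserve `P` and commute modulo `P`. -/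
theorem lieWord_sub_lieWord_mem_of_perm {P : Submodule K L} {C : Set L} {y : ℕ → L}
    (hC : ∀ w ∈ C, ∀ i, ⁅w, y i⁆ ∈ C) (hP : ∀ w ∈ P, ∀ i, ⁅w, y i⁆ ∈ P)
    (hcomm : ∀ w ∈ C, ∀ i j, ⁅⁅w, y i⁆, y j⁆ - ⁅⁅w, y j⁆, y i⁆ ∈ P) {l l' : List ℕ}
    (hl : l.Perm l') {w : L} (hw : w ∈ C) : lieWord y w l - lieWord y w l' ∈ P := by
  induction hl generalizing w with
  | nil => simp
  | cons i _ ih => exact ih (hC w hw i)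
  | swap i j l =>
    simp only [lieWord_cons]
    rw [← lieWord_sub]
    exact lieWord_mem (C := (P : Set L)) hP (hcomm w hw j i) l
  | trans _ _ ih₁ ih₂ =>
    rw [← sub_add_sub_cancel]
    exact P.add_mem (ih₁ hw) (ih₂ hw)

end LieWord

/-! ### Exponent vectors as sorted lists. -/

section ExponentList

/-- The weakly increasing list in which every `i` occurs `k i` times. -/
def exponentList (k : ℕ →₀ ℕ) : List ℕ :=
  (k.support.sort (· ≤ ·)).flatMap fun i => List.replicate (k i) i

theorem count_exponentList (k : ℕ →₀ ℕ) (i : ℕ) : (exponentList k).count i = k i := by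
  have h : ∀ s : List ℕ, s.Nodup →
      (s.flatMap fun i => List.replicate (k i) i).count i = if i ∈ s then k i else 0 := by
    intro s hs
    induction s with
    | nil => simp
    | cons j s ih =>
      rw [List.nodup_cons] at hs
      rw [List.flatMap_cons, List.count_append, ih hs.2, List.count_replicate]
      by_cases hij : j = i
      · subst hij; simp [hs.1]
      · simp [hij, Ne.symm hij]
  rw [exponentList, h _ (Finset.sort_nodup _ _)]
  by_cases hi : k i = 0 <;> simp [hi]

theorem exponentList_perm_iff {k : ℕ →₀ ℕ} {l : List ℕ} :
    (exponentList k).Perm l ↔ ∀ i, k i = l.count i := by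
  simp [List.perm_iff_count, count_exponentList]

theorem exponentList_concat_perm (k : ℕ →₀ ℕ) (i : ℕ) :
    (exponentList (k + Finsupp.single i 1)).Perm (exponentList k ++ [i]) := by
  rw [exponentList_perm_iff]
  intro j
  simp [count_exponentList, Finsupp.single_apply, List.count_singleton]

theorem exists_exponentList_perm (l : List ℕ) : ∃ k, (exponentList k).Perm l :=
  ⟨Multiset.toFinsupp (l : Multiset ℕ), by rw [exponentList_perm_iff]; simp⟩

theorem mem_exponentList {k : ℕ →₀ ℕ} {i : ℕ} : i ∈ exponentList k ↔ i ∈ k.support := by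
  rw [← List.count_pos_iff, count_exponentList, Finsupp.mem_support_iff, Nat.pos_iff_ne_zero]

theorem prod_map_exponentList {M : Type*} [CommMonoid M] (k : ℕ →₀ ℕ) (t : ℕ → M) :
    ((exponentList k).map t).prod = k.prod fun i n => t i ^ n := by
  rw [exponentList, List.map_flatMap, List.flatMap, List.prod_flatten, List.map_map,
    Finsupp.prod, ← Finset.prod_map_toList]
  refine List.Perm.prod_eq ?_
  have : (k.support.sort (· ≤ ·)).Perm k.support.toList := Finset.sort_perm_toList _ _
  refine (this.map _).trans (List.Perm.of_eq (List.map_congr_left fun i _ => ?_))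
  simp

/-- Flattening the powers into one list lets sorting of tails be treated as permutation of lists. -/
theorem lieTail_eq_lieWord {K G : Type*} [Field K] [Group G] (a : FreeLieAlgebra K (ℕ × G))
    (k : ℕ →₀ ℕ) :
    lieTail a k = lieWord (fun i => gradedVar K i (1 : G)) a (exponentList k) := by
  have h : ∀ s : List ℕ, ∀ a : FreeLieAlgebra K (ℕ × G),
      s.foldl (fun b i => lieIter b (gradedVar K i (1 : G)) (k i)) a =
        lieWord (fun i => gradedVar K i (1 : G)) a
          (s.flatMap fun i => List.replicate (k i) i) := by
    intro s
    induction s with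
    | nil => intro a; rfl
    | cons j s ih =>
      intro a
      rw [List.foldl_cons, ih, List.flatMap_cons, lieWord, lieWord, List.foldl_append]
      congr 1
      generalize k j = n
      induction n generalizing a with
      | zero => rfl
      | succ n ihn =>
        rw [lieIter, Function.iterate_succ_apply, List.replicate_succ, List.foldl_cons]
        exact ihn _
  exact h _ a

end ExponentList

/-! ### Linear independence of families of functions. -/

section LinearIndependence

/-- If a linear map kills a linearly independent family `w` and is injective on a family `v`, in the
sense that it maps `v` to a linearly independent family, then `v` and `w` together are linearly
independent. -/
theorem LinearIndependent.sumElim_of_comp {K M N ι κ : Type*} [Field K] [AddCommGroup M]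
    [Module K M] [AddCommGroup N] [Module K N] {v : ι → M} {w : κ → M} (T : M →ₗ[K] N)
    (hv : LinearIndependent K (T ∘ v)) (hw : LinearIndependent K w) (hT : ∀ k, T (w k) = 0) :
    LinearIndependent K (Sum.elim v w) := by
  refine (LinearIndependent.of_comp T hv).sum_type hw ?_
  refine (Submodule.range_ker_disjoint hv).mono_right ?_
  rw [Submodule.span_le]
  rintro _ ⟨k, rfl⟩
  exact hT k

/-- Products `a_i(x) b_k(y)` of linearly independent functions in separate variables are linearly
independent. -/
theorem LinearIndependent.mul_separate {K X Y ι κ : Type*} [Field K] {a : ι → X → K}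
    {b : κ → Y → K} (ha : LinearIndependent K a) (hb : LinearIndependent K b) :
    LinearIndependent K (fun (p : ι × κ) (q : X × Y) => a p.1 q.1 * b p.2 q.2) := by
  classical
  rw [linearIndependent_iff'] at ha hb ⊢
  intro s c hc
  -- Extending the coefficients by zero to a full rectangle of indices lets the sum be split:
  -- independence of b is used for each fixed x, then independence of a.
  let c' : ι × κ → K := fun p => if p ∈ s then c p else 0
  have hc' : ∑ p ∈ s.image Prod.fst ×ˢ s.image Prod.snd,
      c' p • (fun q : X × Y => a p.1 q.1 * b p.2 q.2) = 0 := by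
    rw [← hc]
    symm
    refine Finset.sum_subset_zero_on_sdiff ?_ ?_ ?_
    · exact Finset.subset_product
    · intro p hp
      simp [c', (Finset.mem_sdiff.1 hp).2]
    · intro p hp
      simp [c', hp]
  rw [Finset.sum_product_right] at hc'
  have h₁ : ∀ x, ∀ k ∈ s.image Prod.snd, ∑ i ∈ s.image Prod.fst, c' (i, k) * a i x = 0 := by
    intro x
    refine hb _ (fun k => ∑ i ∈ s.image Prod.fst, c' (i, k) * a i x) ?_
    funext y
    have := congrFun hc' (x, y)
    simpa [Finset.sum_apply, Finset.sum_mul, mul_assoc] using this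
  rintro ⟨i, k⟩ hik
  have h₂ := ha (s.image Prod.fst) (fun i => c' (i, k)) (by
    funext x
    simpa [Finset.sum_apply] using h₁ x k (Finset.mem_image_of_mem Prod.snd hik)) i
      (Finset.mem_image_of_mem Prod.fst hik)
  simpa [c', hik] using h₂

/-- Over an infinite field a polynomial is determined by its values, so independence of monomials
passes to the functions they define. -/
theorem MvPolynomial.linearIndependent_eval_monomial (K σ : Type*) [Field K] [Infinite K] :
    LinearIndependent K (fun (k : σ →₀ ℕ) (t : σ → K) => k.prod fun i n => t i ^ n) := by
  let T : MvPolynomial σ K →ₗ[K] ((σ → K) → K) :=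
    LinearMap.pi fun t => (MvPolynomial.aeval t).toLinearMap
  have hT : LinearMap.ker T = ⊥ := by
    rw [LinearMap.ker_eq_bot']
    intro p hp
    refine MvPolynomial.funext fun t => ?_
    simpa [T, MvPolynomial.aeval_eq_eval] using congrFun hp t
  have := (MvPolynomial.basisMonomials σ K).linearIndependent.map' T hT
  convert! this using 2 with k
  ext t
  simp [T, MvPolynomial.aeval_monomial]

end LinearIndependence

/-! ### Brackets in UT_2 and UT_3 by entries, and the grading. -/

section UpperTriangularEntries

attribute [local instance 100] LieRing.ofAssociativeRing

theorem UT.coe_lie {n : ℕ} {K : Type*} [Field K] (A B : UT n K) :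
    (⁅A, B⁆ : UT n K).1 = A.1 * B.1 - B.1 * A.1 := rfl

theorem UT.lie_apply_two {K : Type*} [Field K] (A B : UT 2 K) :
    ⁅A, B⁆.1 = !![0, A.1 0 0 * B.1 0 1 + A.1 0 1 * B.1 1 1 - B.1 0 0 * A.1 0 1 - B.1 0 1 * A.1 1 1;
      0, 0] := by
  have hA : A.1 1 0 = 0 := A.2 1 0 (by decide)
  have hB : B.1 1 0 = 0 := B.2 1 0 (by decide)
  rw [UT.coe_lie]
  ext i j
  fin_cases i <;> fin_cases j <;>
    simp [Matrix.mul_apply, Fin.sum_univ_two, hA, hB] <;> ring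

theorem UT.ext_two {K : Type*} [Field K] {A B : UT 2 K} (h₀ : A.1 0 0 = B.1 0 0)
    (h₁ : A.1 0 1 = B.1 0 1) (h₂ : A.1 1 1 = B.1 1 1) : A = B := by
  have hA : A.1 1 0 = 0 := A.2 1 0 (by decide)
  have hB : B.1 1 0 = 0 := B.2 1 0 (by decide)
  ext i j
  fin_cases i <;> fin_cases j <;> simp_all

/-- The upper triangular matrix with rows `(a, b)` and `(0, c)`. -/
def UT.mkTwo {K : Type*} [Field K] (a b c : K) : UT 2 K :=
  ⟨!![a, b; 0, c], by
    intro i j hij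
    fin_cases i <;> fin_cases j <;> simp_all⟩

theorem UT.lie_apply_three {K : Type*} [Field K] (A B : UT 3 K) :
    ⁅A, B⁆.1 = !![0,
        A.1 0 0 * B.1 0 1 + A.1 0 1 * B.1 1 1 - (B.1 0 0 * A.1 0 1 + B.1 0 1 * A.1 1 1),
        A.1 0 0 * B.1 0 2 + A.1 0 1 * B.1 1 2 + A.1 0 2 * B.1 2 2 -
          (B.1 0 0 * A.1 0 2 + B.1 0 1 * A.1 1 2 + B.1 0 2 * A.1 2 2);
      0, 0, A.1 1 1 * B.1 1 2 + A.1 1 2 * B.1 2 2 - (B.1 1 1 * A.1 1 2 + B.1 1 2 * A.1 2 2);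
      0, 0, 0] := by
  have hA : A.1 1 0 = 0 := A.2 1 0 (by decide)
  have hB : B.1 1 0 = 0 := B.2 1 0 (by decide)
  have hA' : A.1 2 0 = 0 := A.2 2 0 (by decide)
  have hB' : B.1 2 0 = 0 := B.2 2 0 (by decide)
  have hA'' : A.1 2 1 = 0 := A.2 2 1 (by decide)
  have hB'' : B.1 2 1 = 0 := B.2 2 1 (by decide)
  rw [UT.coe_lie]
  ext i j
  fin_cases i <;> fin_cases j <;>
    simp [Matrix.mul_apply, Fin.sum_univ_three, hA, hB, hA', hB', hA'', hB''] <;> ring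

theorem UT.ext_three {K : Type*} [Field K] {A B : UT 3 K} (h₀ : A.1 0 0 = B.1 0 0)
    (h₁ : A.1 0 1 = B.1 0 1) (h₂ : A.1 0 2 = B.1 0 2) (h₃ : A.1 1 1 = B.1 1 1)
    (h₄ : A.1 1 2 = B.1 1 2) (h₅ : A.1 2 2 = B.1 2 2) : A = B := by
  have hA : A.1 1 0 = 0 := A.2 1 0 (by decide)
  have hB : B.1 1 0 = 0 := B.2 1 0 (by decide)
  have hA' : A.1 2 0 = 0 := A.2 2 0 (by decide)
  have hB' : B.1 2 0 = 0 := B.2 2 0 (by decide)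
  have hA'' : A.1 2 1 = 0 := A.2 2 1 (by decide)
  have hB'' : B.1 2 1 = 0 := B.2 2 1 (by decide)
  ext i j
  fin_cases i <;> fin_cases j <;> simp_all

/-- The embedding of `UT_2` into `UT_3` as the lower right block. -/
def UT.block (K : Type*) [Field K] : UT 2 K →ₗ⁅K⁆ UT 3 K where
  toFun A := ⟨!![0, 0, 0; 0, A.1 0 0, A.1 0 1; 0, 0, A.1 1 1], by
    intro i j hij
    fin_cases i <;> fin_cases j <;> simp_all⟩
  map_add' A B := by
    apply UT.ext_three <;> simp
  map_smul' c A := by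
    apply UT.ext_three <;> simp
  map_lie' {A B} := by
    apply UT.ext_three <;> simp [-LieSubalgebra.coe_bracket, UT.lie_apply_three, UT.lie_apply_two]
    ring

theorem UT.block_apply {K : Type*} [Field K] (A : UT 2 K) :
    (UT.block K A).1 = !![0, 0, 0; 0, A.1 0 0, A.1 0 1; 0, 0, A.1 1 1] := rfl

/-- The matrix `p e_{12}`. -/
def UT.row {K : Type*} [Field K] (p : K) : UT 3 K :=
  ⟨!![0, p, 0; 0, 0, 0; 0, 0, 0], by
    intro i j hij
    fin_cases i <;> fin_cases j <;> simp_all⟩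

theorem UT.row_apply {K : Type*} [Field K] (p : K) :
    (UT.row p).1 = !![0, p, 0; 0, 0, 0; 0, 0, 0] := rfl

section Grading

variable {K : Type*} [Field K] {G : Type*} [Group G] {g : G}

theorem mem_elementaryGrading_one (hg : g ≠ 1) {A : UT 3 K} :
    A ∈ elementaryGrading K g 1 1 ↔ A.1 0 1 = 0 ∧ A.1 0 2 = 0 := by
  change (∀ i j : Fin 3, _) ↔ _
  simp [Fin.forall_fin_succ, unitDegree, hg]

theorem mem_elementaryGrading_self (hg : g ≠ 1) {A : UT 3 K} :
    A ∈ elementaryGrading K g 1 g ↔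
      A.1 0 0 = 0 ∧ A.1 1 1 = 0 ∧ A.1 1 2 = 0 ∧ A.1 2 2 = 0 := by
  change (∀ i j : Fin 3, _) ↔ _
  simp [Fin.forall_fin_succ, unitDegree, hg.symm, and_assoc]

theorem mem_elementaryGrading_of_ne {l : G} (h₁ : l ≠ 1) (h₂ : l ≠ g) {A : UT 3 K} :
    A ∈ elementaryGrading K g 1 l ↔ A = 0 := by
  constructor
  · intro h
    change ∀ i j : Fin 3, _ at h
    simp [Fin.forall_fin_succ, unitDegree, h₁.symm, h₂.symm] at h
    apply UT.ext_three <;> simp [h]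
  · rintro rfl
    exact Submodule.zero_mem _

theorem lie_mem_elementaryGrading (hg : g ≠ 1) {h k : G} {A B : UT 3 K}
    (hA : A ∈ elementaryGrading K g 1 h) (hB : B ∈ elementaryGrading K g 1 k) :
    ⁅A, B⁆ ∈ elementaryGrading K g 1 (h * k) := by
  by_cases h1 : h = 1
  · subst h1
    rw [one_mul]
    by_cases k1 : k = 1
    · subst k1
      rw [mem_elementaryGrading_one hg] at *
      simp [-LieSubalgebra.coe_bracket, UT.lie_apply_three, hA, hB]
    by_cases k2 : k = g
    · subst k2
      rw [mem_elementaryGrading_one hg] at hA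
      rw [mem_elementaryGrading_self hg] at *
      simp [-LieSubalgebra.coe_bracket, UT.lie_apply_three, hA, hB]
    rw [mem_elementaryGrading_of_ne k1 k2] at *
    simp [hB]
  by_cases h2 : h = g
  · subst h2
    by_cases k1 : k = 1
    · subst k1
      rw [mul_one]
      rw [mem_elementaryGrading_one hg] at hB
      rw [mem_elementaryGrading_self hg] at *
      simp [-LieSubalgebra.coe_bracket, UT.lie_apply_three, hA, hB]
    by_cases k2 : k = h
    · subst k2
      rw [mem_elementaryGrading_self hg] at hA hB
      -- The component of degree g is abelian, so it does not matter which component belongs to g².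
      have : ⁅A, B⁆ = 0 := by
        apply UT.ext_three <;> simp [-LieSubalgebra.coe_bracket, UT.lie_apply_three, hA, hB]
      rw [this]
      exact Submodule.zero_mem _
    rw [mem_elementaryGrading_of_ne k1 k2] at hB
    simp [hB]
  rw [mem_elementaryGrading_of_ne h1 h2] at hA
  simp [hA]

end Grading

end UpperTriangularEntries

/-! ### Graded evaluations in UT_3 through the lower right block. -/

section Evaluations

variable {K : Type*} [Field K]

theorem mem_identities {A : Type*} [LieRing A] [LieAlgebra K A] {f : FreeLieAlgebra K ℕ} :
    f ∈ identities K A ↔ ∀ φ : FreeLieAlgebra K ℕ →ₗ⁅K⁆ A, φ f = 0 := by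
  simp [identities, LieSubmodule.mem_iInf, LieHom.mem_ker]

theorem mem_gradedIdentities {G A : Type*} [LieRing A] [LieAlgebra K A] {𝒜 : G → Submodule K A}
    {f : FreeLieAlgebra K (ℕ × G)} :
    f ∈ gradedIdentities 𝒜 ↔ ∀ φ : FreeLieAlgebra K (ℕ × G) →ₗ⁅K⁆ A,
      (∀ i h, φ (gradedVar K i h) ∈ 𝒜 h) → φ f = 0 := by
  simp [gradedIdentities, LieSubmodule.mem_iInf, LieHom.mem_ker]

variable {G : Type*} [Group G] {g : G}

open Classical in
/-- The homomorphism with `y_i ↦ a_i`, `z_i ↦ b_i`, and `x_{i,l} ↦ c_{i,l}` for the remaining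
variables. -/
noncomputable def gradedSubst {L : Type*} [LieRing L] [LieAlgebra K L] (g : G) (a b : ℕ → L)
    (c : ℕ → G → L) : FreeLieAlgebra K (ℕ × G) →ₗ⁅K⁆ L :=
  FreeLieAlgebra.lift K fun p =>
    if p.2 = 1 then a p.1 else if p.2 = g then b p.1 else c p.1 p.2

section

variable {L : Type*} [LieRing L] [LieAlgebra K L] (a b : ℕ → L) (c : ℕ → G → L)

@[simp] theorem gradedSubst_one (i : ℕ) : gradedSubst (K := K) g a b c (gradedVar K i 1) = a i := by
  simp [gradedSubst, gradedVar]

theorem gradedSubst_self (hg : g ≠ 1) (i : ℕ) :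
    gradedSubst (K := K) g a b c (gradedVar K i g) = b i := by
  simp [gradedSubst, gradedVar, hg]

theorem gradedSubst_mem {𝒜 : G → Submodule K L} (ha : ∀ i, a i ∈ 𝒜 1) (hb : ∀ i, b i ∈ 𝒜 g)
    (hc : ∀ i h, c i h ∈ 𝒜 h) (i : ℕ) (h : G) :
    gradedSubst (K := K) g a b c (gradedVar K i h) ∈ 𝒜 h := by
  by_cases h₁ : h = 1
  · subst h₁; simpa using ha i
  by_cases h₂ : h = g
  · subst h₂; rw [gradedSubst_self _ _ _ h₁]; exact hb i
  simpa [gradedSubst, gradedVar, h₁, h₂] using hc i h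

end

@[simp] theorem inclY_of (i : ℕ) : inclY K G (FreeLieAlgebra.of K i) = gradedVar K i 1 := by
  simp [inclY]

theorem map_inclY_eq {L : Type*} [LieRing L] [LieAlgebra K L]
    (φ : FreeLieAlgebra K (ℕ × G) →ₗ⁅K⁆ L) (ψ : FreeLieAlgebra K ℕ →ₗ⁅K⁆ L)
    (h : ∀ i, φ (gradedVar K i 1) = ψ (FreeLieAlgebra.of K i)) (f : FreeLieAlgebra K ℕ) :
    φ (inclY K G f) = ψ f := by
  have : φ.comp (inclY K G) = ψ := FreeLieAlgebra.hom_ext fun i => by simp [h]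
  rw [← this]; rfl

/-- The evaluation in `UT_3` with `y_i ↦ χ(y_i)`, placed in the lower right block, and
`z_i ↦ p_i e_{12}`. -/
noncomputable def blockEval (g : G) (χ : FreeLieAlgebra K ℕ →ₗ⁅K⁆ UT 2 K) (p : ℕ → K) :
    FreeLieAlgebra K (ℕ × G) →ₗ⁅K⁆ UT 3 K :=
  gradedSubst g (fun i => UT.block K (χ (FreeLieAlgebra.of K i))) (fun i => UT.row (p i))
    fun _ _ => 0

theorem blockEval_inclY (χ : FreeLieAlgebra K ℕ →ₗ⁅K⁆ UT 2 K) (p : ℕ → K)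
    (f : FreeLieAlgebra K ℕ) : blockEval g χ p (inclY K G f) = UT.block K (χ f) :=
  map_inclY_eq (blockEval g χ p) ((UT.block K).comp χ) (by simp [blockEval]) f

theorem blockEval_eq_zero (hg : g ≠ 1) (χ : FreeLieAlgebra K ℕ →ₗ⁅K⁆ UT 2 K) (p : ℕ → K)
    {f : FreeLieAlgebra K (ℕ × G)} (hf : f ∈ gradedIdentities (elementaryGrading K g 1)) :
    blockEval g χ p f = 0 := by
  refine mem_gradedIdentities.1 hf _ (gradedSubst_mem _ _ _ ?_ ?_ ?_)
  · intro i
    rw [mem_elementaryGrading_one hg]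
    simp [UT.block_apply]
  · intro i
    rw [mem_elementaryGrading_self hg]
    simp [UT.row_apply]
  · intro i h
    exact Submodule.zero_mem _

/-- The lower right block is a copy of UT_2 lying in degree 1. -/
theorem inclY_mem_gradedIdentities (hg : g ≠ 1) {f : FreeLieAlgebra K ℕ}
    (hf : inclY K G f ∈ gradedIdentities (elementaryGrading K g 1)) :
    f ∈ identities K (UT 2 K) := by
  refine mem_identities.2 fun χ => ?_
  have := blockEval_eq_zero hg χ 0 hf
  rw [blockEval_inclY] at this
  have h : ∀ i j, (UT.block K (χ f)).1 i j = 0 := by simp [this]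
  simp only [UT.block_apply] at h
  exact UT.ext_two (by simpa using h 1 1) (by simpa using h 1 2) (by simpa using h 2 2)

/-- The first row of a block matrix is zero, so bracketing with it acts on the first row of A by
right multiplication; on the e_12 entry this is scaling by the first diagonal entry of the block. -/
theorem lieWord_row (U : ℕ → UT 2 K) {A : UT 3 K} (hA : A.1 0 0 = 0) (l : List ℕ) :
    (lieWord (fun i => UT.block K (U i)) A l).1 0 1 =
      A.1 0 1 * (l.map fun i => (U i).1 0 0).prod := by
  induction l generalizing A with
  | nil => simp
  | cons i l ih =>
    rw [lieWord_cons, ih (by simp [-LieSubalgebra.coe_bracket, UT.lie_apply_three])]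
    simp [-LieSubalgebra.coe_bracket, UT.lie_apply_three, UT.block_apply, hA, mul_assoc]

/-- Without an e_12 entry nothing feeds into e_13, which is then scaled by the second diagonal entry
of the block. -/
theorem lieWord_row' (U : ℕ → UT 2 K) {A : UT 3 K} (hA : A.1 0 0 = 0) (hA' : A.1 0 1 = 0)
    (l : List ℕ) :
    (lieWord (fun i => UT.block K (U i)) A l).1 0 2 =
      A.1 0 2 * (l.map fun i => (U i).1 1 1).prod := by
  induction l generalizing A with
  | nil => simp
  | cons i l ih =>
    rw [lieWord_cons, ih (by simp [-LieSubalgebra.coe_bracket, UT.lie_apply_three])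
      (by simp [-LieSubalgebra.coe_bracket, UT.lie_apply_three, UT.block_apply, hA, hA'])]
    simp [-LieSubalgebra.coe_bracket, UT.lie_apply_three, UT.block_apply, hA, hA', mul_assoc]

end Evaluations

/-! ### The ordinary identities of UT_2. -/

section MetabelianIdentities

/-- The form of the Jacobi identity behind every reordering below: exchanging two neighbouring
entries costs a bracket with their commutator. -/
theorem lie_lie_sub_lie_lie {L : Type*} [LieRing L] (w a b : L) :
    ⁅⁅w, a⁆, b⁆ - ⁅⁅w, b⁆, a⁆ = ⁅w, ⁅a, b⁆⁆ := by
  rw [leibniz_lie w a b, ← lie_skew a]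
  abel

/-- The linear map `a ↦ [a, x]`. -/
def lieRight (K : Type*) {L : Type*} [CommRing K] [LieRing L] [LieAlgebra K L] (x : L) :
    L →ₗ[K] L :=
  -(LieModule.toEnd K L L x)

@[simp] theorem lieRight_apply {K L : Type*} [CommRing K] [LieRing L] [LieAlgebra K L] (x a : L) :
    lieRight K x a = ⁅a, x⁆ := by
  simp [lieRight]

/-- The span of all brackets of a Lie algebra. -/
def bracketSpan (K L : Type*) [CommRing K] [LieRing L] [LieAlgebra K L] : Submodule K L :=
  Submodule.span K {x | ∃ a b : L, ⁅a, b⁆ = x}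

theorem lie_mem_bracketSpan {K L : Type*} [CommRing K] [LieRing L] [LieAlgebra K L] (a b : L) :
    ⁅a, b⁆ ∈ bracketSpan K L :=
  Submodule.subset_span ⟨a, b, rfl⟩

variable {K : Type*} [Field K]

section

attribute [local instance 100] LieRing.ofAssociativeRing

/-- The matrix entry as a linear functional on upper triangular matrices. -/
def UT.entry (K : Type*) [Field K] {n : ℕ} (i j : Fin n) : UT n K →ₗ[K] K :=
  (Matrix.entryLinearMap K K i j).comp (UT n K).toSubmodule.subtype

@[simp] theorem UT.entry_apply {n : ℕ} (i j : Fin n) (A : UT n K) : UT.entry K i j A = A.1 i j :=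
  rfl

end

theorem lieWord_mkTwo (b t : ℕ → K) {A : UT 2 K} (h₀ : A.1 0 0 = 0) (h₁ : A.1 1 1 = 0)
    (l : List ℕ) :
    (lieWord (fun i => UT.mkTwo 0 (b i) (t i)) A l).1 0 1 = A.1 0 1 * (l.map t).prod := by
  induction l generalizing A with
  | nil => simp
  | cons i l ih =>
    rw [lieWord_cons, ih (by simp [-LieSubalgebra.coe_bracket, UT.lie_apply_two])
      (by simp [-LieSubalgebra.coe_bracket, UT.lie_apply_two])]
    simp [-LieSubalgebra.coe_bracket, UT.lie_apply_two, UT.mkTwo, h₀, h₁, mul_assoc]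

/-- The left-normed commutator `[y_i, y_j, y_{i_1}^{(k_1)}, …]`. -/
noncomputable def metabelianWord (K : Type*) [Field K] (p : ℕ × ℕ × (ℕ →₀ ℕ)) :
    FreeLieAlgebra K ℕ :=
  lieWord (FreeLieAlgebra.of K) ⁅FreeLieAlgebra.of K p.1, FreeLieAlgebra.of K p.2.1⁆
    (exponentList p.2.2)

/-- The indices `(i, j, k)` with `j < i` and `j ≤ s` for all `s` in the support of `k`. -/
def metabelianIndex : Set (ℕ × ℕ × (ℕ →₀ ℕ)) :=
  {p | p.2.1 < p.1 ∧ ∀ s ∈ p.2.2.support, p.2.1 ≤ s}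

theorem lieWord_mem_span_metabelianWord {N : LieIdeal K (FreeLieAlgebra K ℕ)}
    (hN : ∀ a b c d : FreeLieAlgebra K ℕ, ⁅⁅a, b⁆, ⁅c, d⁆⁆ ∈ N) (i j : ℕ) (l : List ℕ) :
    lieWord (FreeLieAlgebra.of K) ⁅FreeLieAlgebra.of K i, FreeLieAlgebra.of K j⁆ l ∈
      Submodule.span K (metabelianWord K '' metabelianIndex) ⊔ N.toSubmodule := by
  set R := Submodule.span K (metabelianWord K '' metabelianIndex) ⊔ N.toSubmodule with hR
  let y : ℕ → FreeLieAlgebra K ℕ := FreeLieAlgebra.of K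
  have hcomm : ∀ w ∈ (bracketSpan K (FreeLieAlgebra K ℕ) : Set (FreeLieAlgebra K ℕ)), ∀ i j,
      ⁅⁅w, y i⁆, y j⁆ - ⁅⁅w, y j⁆, y i⁆ ∈ N.toSubmodule := by
    intro w hw i j
    rw [lie_lie_sub_lie_lie]
    induction hw using Submodule.span_induction with
    | mem x hx =>
      obtain ⟨a, b, rfl⟩ := hx
      exact hN _ _ _ _
    | zero => simp
    | add a b _ _ ha hb => rw [add_lie]; exact add_mem ha hb
    | smul r a _ ha => rw [smul_lie]; exact Submodule.smul_mem _ _ ha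
  have hperm : ∀ {l l' : List ℕ} (i j : ℕ), l.Perm l' →
      lieWord y ⁅y i, y j⁆ l - lieWord y ⁅y i, y j⁆ l' ∈ N.toSubmodule := fun i j h =>
    lieWord_sub_lieWord_mem_of_perm (fun w _ i => lie_mem_bracketSpan w _)
      (fun w hw i => lie_mem_left K _ N _ _ hw) hcomm h (lie_mem_bracketSpan _ _)
  have h₁ : ∀ i m l, m ≤ i → (∀ s ∈ l, m ≤ s) → lieWord y ⁅y i, y m⁆ l ∈ R := by
    intro i m l hi hl
    rcases hi.eq_or_lt with rfl | hi
    · rw [lie_self, lieWord_zero]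
      exact zero_mem _
    · obtain ⟨k, hk⟩ := exists_exponentList_perm l
      have := hperm i m hk.symm
      rw [← sub_add_cancel (lieWord y ⁅y i, y m⁆ l)]
      refine add_mem (Submodule.mem_sup_right this) (Submodule.mem_sup_left ?_)
      refine Submodule.subset_span ⟨(i, m, k), ⟨hi, fun s hs => hl s ?_⟩, rfl⟩
      exact hk.mem_iff.1 (mem_exponentList.2 hs)
  -- The smallest index has to reach the second position. If it comes first, antisymmetry moves it
  -- there; if it lies in the tail, it is brought to the front of the tail and the Jacobi identity
  -- is applied.
  obtain ⟨m, hm, hmin⟩ := Finset.exists_min_image (i :: j :: l).toFinset id ⟨i, by simp⟩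
  simp only [List.mem_toFinset, List.mem_cons, id] at hm hmin
  rcases hm with rfl | rfl | hm
  · change lieWord y _ l ∈ R
    rw [← lie_skew, lieWord_neg]
    exact neg_mem (h₁ _ _ _ (hmin j (by simp)) fun s hs => hmin s (by simp [hs]))
  · exact h₁ _ _ _ (hmin i (by simp)) fun s hs => hmin s (by simp [hs])
  · have hl := List.perm_cons_erase hm
    have hjac : ⁅⁅y i, y j⁆, y m⁆ = ⁅⁅y i, y m⁆, y j⁆ - ⁅⁅y j, y m⁆, y i⁆ := by
      rw [← sub_add_cancel ⁅⁅y i, y j⁆, y m⁆ ⁅⁅y i, y m⁆, y j⁆, lie_lie_sub_lie_lie,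
        ← lie_skew (y i) ⁅y j, y m⁆]
      abel
    rw [← sub_add_cancel (lieWord (FreeLieAlgebra.of K) _ l)]
    refine add_mem (Submodule.mem_sup_right (hperm i j hl)) ?_
    rw [lieWord_cons, hjac, lieWord_sub, ← lieWord_cons, ← lieWord_cons]
    have hle : ∀ s ∈ l.erase m, m ≤ s := fun s hs => hmin s (by simp [List.mem_of_mem_erase hs])
    refine sub_mem (h₁ i m (j :: l.erase m) (hmin i (by simp)) ?_)
      (h₁ j m (i :: l.erase m) (hmin j (by simp)) ?_)
    · simpa using ⟨hmin j (by simp), hle⟩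
    · simpa using ⟨hmin i (by simp), hle⟩

theorem mem_span_metabelianWord {N : LieIdeal K (FreeLieAlgebra K ℕ)}
    (hN : ∀ a b c d : FreeLieAlgebra K ℕ, ⁅⁅a, b⁆, ⁅c, d⁆⁆ ∈ N) (f : FreeLieAlgebra K ℕ) :
    f ∈ Submodule.span K (Set.range (FreeLieAlgebra.of K)) ⊔
      (Submodule.span K (metabelianWord K '' metabelianIndex) ⊔ N.toSubmodule) := by
  have hw := lieWord_mem_span_metabelianWord hN
  refine FreeLieAlgebra.mem_of_forall_lie_of_mem _
    (fun i => Submodule.mem_sup_left (Submodule.subset_span (Set.mem_range_self i))) ?_ f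
  intro a ha x
  refine Submodule.mem_sup_right ?_
  rw [← lieRight_apply (K := K), ← Submodule.mem_comap]
  refine (sup_le ?_ (sup_le ?_ ?_) : Submodule.span K (Set.range (FreeLieAlgebra.of K)) ⊔
    (Submodule.span K (metabelianWord K '' metabelianIndex) ⊔ N.toSubmodule) ≤ _) ha
  · rw [Submodule.span_le]
    rintro _ ⟨i, rfl⟩
    simpa using hw i x []
  · rw [Submodule.span_le]
    rintro _ ⟨p, hp, rfl⟩
    have := hw p.1 p.2.1 (exponentList p.2.2 ++ [x])
    rw [lieWord_concat] at this
    rw [SetLike.mem_coe, Submodule.mem_comap, lieRight_apply]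
    exact this
  · intro b hb
    rw [Submodule.mem_comap, lieRight_apply]
    exact Submodule.mem_sup_right (lie_mem_left K _ N _ _ hb)

/-- The evaluation `y_i ↦ b_i e_{12} + t_i e_{22}` in `UT_2`. -/
noncomputable def affineEval (b t : ℕ → K) : FreeLieAlgebra K ℕ →ₗ⁅K⁆ UT 2 K :=
  FreeLieAlgebra.lift K fun i => UT.mkTwo 0 (b i) (t i)

theorem affineEval_metabelianWord (b t : ℕ → K) (p : ℕ × ℕ × (ℕ →₀ ℕ)) :
    (affineEval b t (metabelianWord K p)).1 0 1 =
      (b p.1 * t p.2.1 - b p.2.1 * t p.1) * p.2.2.prod fun i n => t i ^ n := by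
  rw [metabelianWord, map_lieWord]
  simp only [affineEval, FreeLieAlgebra.lift_of_apply, LieHom.map_lie]
  rw [lieWord_mkTwo _ _ (by simp [-LieSubalgebra.coe_bracket, UT.lie_apply_two])
    (by simp [-LieSubalgebra.coe_bracket, UT.lie_apply_two]), prod_map_exponentList]
  simp [-LieSubalgebra.coe_bracket, UT.lie_apply_two, UT.mkTwo]

theorem apply_diag_of_mem_bracketSpan (χ : FreeLieAlgebra K ℕ →ₗ⁅K⁆ UT 2 K)
    {f : FreeLieAlgebra K ℕ} (hf : f ∈ bracketSpan K (FreeLieAlgebra K ℕ)) :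
    (χ f).1 0 0 = 0 ∧ (χ f).1 1 1 = 0 := by
  have : bracketSpan K (FreeLieAlgebra K ℕ) ≤
      LinearMap.ker ((UT.entry K 0 0).comp χ.toLinearMap) ⊓
        LinearMap.ker ((UT.entry K 1 1).comp χ.toLinearMap) := by
    rw [bracketSpan, Submodule.span_le]
    rintro _ ⟨a, b, rfl⟩
    constructor <;> simp [-LieSubalgebra.coe_bracket, UT.lie_apply_two]
  simpa using this hf

theorem metabelianWord_mem_bracketSpan (p : ℕ × ℕ × (ℕ →₀ ℕ)) :
    metabelianWord K p ∈ bracketSpan K (FreeLieAlgebra K ℕ) :=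
  lieWord_mem (C := (bracketSpan K (FreeLieAlgebra K ℕ) : Set (FreeLieAlgebra K ℕ)))
    (fun _ _ _ => lie_mem_bracketSpan _ _) (lie_mem_bracketSpan _ _) (exponentList p.2.2)

/-- A linear combination of generators that takes the same value on diagonal matrices as an element
of the derived algebra is zero. -/
theorem eq_zero_of_mem_span_of {f d : FreeLieAlgebra K ℕ}
    (hf : f ∈ Submodule.span K (Set.range (FreeLieAlgebra.of K)))
    (hd : d ∈ bracketSpan K (FreeLieAlgebra K ℕ)) (h : f + d ∈ identities K (UT 2 K)) : f = 0 := by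
  obtain ⟨c, rfl⟩ := Finsupp.mem_span_range_iff_exists_finsupp.1 hf
  suffices c = 0 by simp [this]
  ext i
  -- The diagonal evaluation with y_i ↦ e_22 and all other variables ↦ 0 kills brackets and reads
  -- off the coefficient of y_i.
  have h₁ := congrArg (fun A => UT.entry K 1 1 A)
    (mem_identities.1 h (affineEval 0 (Pi.single i 1)))
  have h₂ := (apply_diag_of_mem_bracketSpan (affineEval 0 (Pi.single i 1)) hd).2
  simp only [map_add, UT.entry_apply, map_zero, Finsupp.sum, map_sum, map_smul] at h₁
  rw [h₂, add_zero] at h₁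
  simpa [affineEval, UT.mkTwo, Pi.single_apply, eq_comm] using h₁

theorem eq_zero_of_mem_span_metabelianWord [Infinite K] {f : FreeLieAlgebra K ℕ}
    (hf : f ∈ Submodule.span K (metabelianWord K '' metabelianIndex))
    (h : f ∈ identities K (UT 2 K)) : f = 0 := by
  obtain ⟨c, hc, rfl⟩ := (Finsupp.mem_span_image_iff_linearCombination K).1 hf
  suffices c = 0 by simp [this]
  ext p
  by_cases hp : p ∈ c.support
  swap
  · simpa using hp
  have hps : p ∈ metabelianIndex := hc hp
  -- With b the indicator of the first index of p, the e_12 entry of the evaluation is the value at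
  -- t of this polynomial. Its coefficient at the leading monomial of the word p will be the
  -- coefficient of p in c.
  let Q : MvPolynomial ℕ K := c.sum fun q a => a •
    ((if q.1 = p.1 then MvPolynomial.monomial (q.2.2 + Finsupp.single q.2.1 1) 1 else 0) -
      (if q.2.1 = p.1 then MvPolynomial.monomial (q.2.2 + Finsupp.single q.1 1) 1 else 0))
  have hQ : Q = 0 := by
    refine MvPolynomial.funext fun t => ?_
    have h₁ := congrArg (fun A => UT.entry K 0 1 A)
      (mem_identities.1 h (affineEval (Pi.single p.1 1) t))
    simp only [Finsupp.linearCombination_apply, Finsupp.sum, map_sum, map_smul, map_zero,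
      UT.entry_apply, affineEval_metabelianWord] at h₁
    simp only [Q, Finsupp.sum, map_sum, map_zero, MvPolynomial.smul_eval]
    rw [← h₁]
    refine Finset.sum_congr rfl fun q _ => ?_
    rw [smul_eq_mul]
    congr 1
    rw [map_sub, sub_mul]
    congr 1 <;> split_ifs with hq <;>
      simp [hq, MvPolynomial.eval_monomial, Finsupp.prod_add_index', pow_add,
        mul_comm]
  have hQ' := congrArg (MvPolynomial.coeff (p.2.2 + Finsupp.single p.2.1 1)) hQ
  simp only [Q, Finsupp.sum, MvPolynomial.coeff_sum, MvPolynomial.coeff_smul,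
    MvPolynomial.coeff_sub, MvPolynomial.coeff_zero] at hQ'
  -- The second index of an admissible word is the smallest variable of its monomial, so the
  -- monomial determines it.
  have hmin : ∀ q ∈ metabelianIndex, ∀ r : ℕ × ℕ × (ℕ →₀ ℕ), ∀ s,
      q.2.2 + Finsupp.single q.2.1 1 = r.2.2 + Finsupp.single s 1 → q.2.1 ≤ s := by
    intro q hq r s hqs
    have : s ∈ (q.2.2 + Finsupp.single q.2.1 1).support := by simp [hqs]
    rcases Finset.mem_union.1 (Finsupp.support_add this) with h' | h'
    · exact hq.2 s h'
    · rw [Finset.mem_singleton.1 (Finsupp.support_single_subset h')]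
  rw [Finset.sum_eq_single p] at hQ'
  · simpa [hps.1.ne] using hQ'
  · intro q hq hqp
    have hqs : q ∈ metabelianIndex := hc hq
    have e₁ : ¬ (q.1 = p.1 ∧ q.2.2 + Finsupp.single q.2.1 1 = p.2.2 + Finsupp.single p.2.1 1) := by
      rintro ⟨h₁, h₂⟩
      have h₃ : q.2.1 = p.2.1 := le_antisymm (hmin q hqs p _ h₂) (hmin p hps q _ h₂.symm)
      rw [h₃, add_left_inj] at h₂
      exact hqp (Prod.ext h₁ (Prod.ext h₃ h₂))
    -- Here all variables on the left are at least the first index of p, while the second index of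
    -- p, which is smaller, occurs on the right.
    have e₂ : ¬ (q.2.1 = p.1 ∧ q.2.2 + Finsupp.single q.1 1 = p.2.2 + Finsupp.single p.2.1 1) := by
      rintro ⟨h₁, h₂⟩
      have h₃ : p.2.1 ∈ (q.2.2 + Finsupp.single q.1 1).support := by simp [h₂]
      have h₄ := hps.1
      have h₅ := hqs.1
      rcases Finset.mem_union.1 (Finsupp.support_add h₃) with h' | h'
      · have := hqs.2 _ h'
        omega
      · have := Finset.mem_singleton.1 (Finsupp.support_single_subset h')
        omega
    have c₁ : MvPolynomial.coeff (p.2.2 + Finsupp.single p.2.1 1) (if q.1 = p.1 then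
        MvPolynomial.monomial (q.2.2 + Finsupp.single q.2.1 1) (1 : K) else 0) = 0 := by
      split_ifs with h'
      · rw [MvPolynomial.coeff_monomial, if_neg fun h'' => e₁ ⟨h', h''⟩]
      · simp
    have c₂ : MvPolynomial.coeff (p.2.2 + Finsupp.single p.2.1 1) (if q.2.1 = p.1 then
        MvPolynomial.monomial (q.2.2 + Finsupp.single q.1 1) (1 : K) else 0) = 0 := by
      split_ifs with h'
      · rw [MvPolynomial.coeff_monomial, if_neg fun h'' => e₂ ⟨h', h''⟩]
      · simp
    rw [c₁, c₂]
    simp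
  · intro h'
    exact absurd hp h'

/-- The identities of `UT_2` follow from the metabelian identity. -/
theorem identities_le_of_lie_lie_mem [Infinite K] {N : LieIdeal K (FreeLieAlgebra K ℕ)}
    (hN : ∀ a b c d : FreeLieAlgebra K ℕ, ⁅⁅a, b⁆, ⁅c, d⁆⁆ ∈ N)
    (hle : N ≤ identities K (UT 2 K)) : identities K (UT 2 K) ≤ N := by
  intro f hf
  obtain ⟨a, ha, r, hr, rfl⟩ := Submodule.mem_sup.1 (mem_span_metabelianWord hN f)
  obtain ⟨d, hd, n, hn, rfl⟩ := Submodule.mem_sup.1 hr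
  have hn' : n ∈ N := hn
  have hdn : a + d ∈ identities K (UT 2 K) := by
    have := sub_mem hf (hle hn')
    rwa [← add_assoc, add_sub_cancel_right] at this
  have hd' : d ∈ bracketSpan K (FreeLieAlgebra K ℕ) := by
    refine (Submodule.span_le.2 ?_ : _ ≤ bracketSpan K (FreeLieAlgebra K ℕ)) hd
    rintro _ ⟨p, -, rfl⟩
    exact metabelianWord_mem_bracketSpan p
  obtain rfl := eq_zero_of_mem_span_of ha hd' hdn
  rw [zero_add] at hdn
  obtain rfl := eq_zero_of_mem_span_metabelianWord hd hdn
  simpa using hn'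

end MetabelianIdentities

/-! ### T_G-ideals and the proposed generators. -/

section GradedIdeals

variable {K : Type*} [Field K] {G : Type*} [Group G] {g : G}

theorem gradedVar_mem_freeComponent (i : ℕ) (h : G) :
    gradedVar K i h ∈ freeComponent K h :=
  Submodule.subset_span (IsMonomialOfDegree.of_var i h)

theorem lie_mem_freeComponent {h k : G} {a b : FreeLieAlgebra K (ℕ × G)}
    (ha : a ∈ freeComponent K h) (hb : b ∈ freeComponent K k) :
    ⁅a, b⁆ ∈ freeComponent K (h * k) := by
  induction ha using Submodule.span_induction with
  | mem a ha =>
    induction hb using Submodule.span_induction with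
    | mem b hb => exact Submodule.subset_span (IsMonomialOfDegree.of_lie h k a b ha hb)
    | zero => rw [lie_zero]; exact zero_mem _
    | add b c _ _ hb hc => rw [lie_add]; exact add_mem hb hc
    | smul r b _ hb => rw [lie_smul]; exact Submodule.smul_mem _ r hb
  | zero => rw [zero_lie]; exact zero_mem _
  | add a c _ _ ha hc => rw [add_lie]; exact add_mem ha hc
  | smul r a _ ha => rw [smul_lie]; exact Submodule.smul_mem _ r ha

theorem inclY_mem_freeComponent (f : FreeLieAlgebra K ℕ) :
    inclY K G f ∈ freeComponent K (1 : G) := by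
  let S : LieSubalgebra K (FreeLieAlgebra K ℕ) :=
    { (freeComponent K (1 : G)).comap (inclY K G).toLinearMap with
      lie_mem' := fun {a b} ha hb => by
        change inclY K G ⁅a, b⁆ ∈ freeComponent K (1 : G)
        rw [LieHom.map_lie, ← one_mul (1 : G)]
        exact lie_mem_freeComponent ha hb }
  refine FreeLieAlgebra.mem_of_forall_of_mem S (fun i => ?_) f
  change inclY K G (FreeLieAlgebra.of K i) ∈ freeComponent K (1 : G)
  rw [inclY_of]
  exact gradedVar_mem_freeComponent i 1

theorem map_mem_of_mem_freeComponent {L : Type*} [LieRing L] [LieAlgebra K L]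
    {𝒜 : G → Submodule K L} (h𝒜 : ∀ h k a b, a ∈ 𝒜 h → b ∈ 𝒜 k → ⁅a, b⁆ ∈ 𝒜 (h * k))
    {φ : FreeLieAlgebra K (ℕ × G) →ₗ⁅K⁆ L} (hφ : ∀ i h, φ (gradedVar K i h) ∈ 𝒜 h) {h : G}
    {a : FreeLieAlgebra K (ℕ × G)} (ha : a ∈ freeComponent K h) : φ a ∈ 𝒜 h := by
  have : freeComponent K h ≤ (𝒜 h).comap φ.toLinearMap := by
    clear ha
    rw [freeComponent, Submodule.span_le]
    intro a (ha : IsMonomialOfDegree K h a)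
    change φ a ∈ 𝒜 h
    induction ha with
    | of_var i h => exact hφ i h
    | of_lie h k a b _ _ iha ihb =>
      rw [LieHom.map_lie]
      exact h𝒜 h k _ _ iha ihb
  exact this ha

/-- A graded endomorphism followed by a graded evaluation is again a graded evaluation. -/
theorem isTGIdeal_gradedIdentities {A : Type*} [LieRing A] [LieAlgebra K A]
    {𝒜 : G → Submodule K A} (h𝒜 : ∀ h k a b, a ∈ 𝒜 h → b ∈ 𝒜 k → ⁅a, b⁆ ∈ 𝒜 (h * k)) :
    IsTGIdeal (gradedIdentities 𝒜) := by
  intro φ hφ f hf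
  rw [mem_gradedIdentities] at hf ⊢
  intro ψ hψ
  refine hf (ψ.comp φ) fun i h => ?_
  exact map_mem_of_mem_freeComponent h𝒜 hψ (hφ i h)

theorem mem_tgIdealSpan {S : Set (FreeLieAlgebra K (ℕ × G))} {f : FreeLieAlgebra K (ℕ × G)} :
    f ∈ tgIdealSpan S ↔
      ∀ I : LieIdeal K (FreeLieAlgebra K (ℕ × G)), IsTGIdeal I → (∀ f ∈ S, f ∈ I) → f ∈ I := by
  rw [tgIdealSpan, ← SetLike.mem_coe, LieSubmodule.coe_sInf]
  simp

theorem subset_tgIdealSpan {S : Set (FreeLieAlgebra K (ℕ × G))} {f : FreeLieAlgebra K (ℕ × G)}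
    (hf : f ∈ S) : f ∈ tgIdealSpan S :=
  mem_tgIdealSpan.2 fun _ _ hS => hS f hf

theorem tgIdealSpan_le {S : Set (FreeLieAlgebra K (ℕ × G))}
    {I : LieIdeal K (FreeLieAlgebra K (ℕ × G))} (hI : IsTGIdeal I) (hS : ∀ f ∈ S, f ∈ I) :
    tgIdealSpan S ≤ I :=
  fun _ hf => mem_tgIdealSpan.1 hf I hI hS

theorem isTGIdeal_tgIdealSpan (S : Set (FreeLieAlgebra K (ℕ × G))) :
    IsTGIdeal (tgIdealSpan S) := by
  intro φ hφ f hf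
  rw [mem_tgIdealSpan] at hf ⊢
  exact fun I hI hS => hI φ hφ f (hf I hI hS)

/-- The proposed generators of the graded identities of `UT_3` with the grading `Γ(g, 1)`. -/
def gradedGenerators (K : Type*) [Field K] {G : Type*} [Group G] (g : G) :
    Set (FreeLieAlgebra K (ℕ × G)) :=
  let y : ℕ → FreeLieAlgebra K (ℕ × G) := fun i => gradedVar K i 1
  let z : ℕ → FreeLieAlgebra K (ℕ × G) := fun i => gradedVar K i g
  {f | ∃ l : G, l ≠ 1 ∧ l ≠ g ∧ f = gradedVar K 1 l} ∪
    {⁅z 1, z 2⁆, ⁅⁅y 1, y 2⁆, ⁅y 3, y 4⁆⁆, ⁅⁅z 1, ⁅y 2, y 3⁆⁆, ⁅y 4, y 5⁆⁆}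

/-- The consequences of the proposed generators, for arbitrary homogeneous arguments. -/
structure ContainsGradedRelations (g : G) (I : LieIdeal K (FreeLieAlgebra K (ℕ × G))) : Prop where
  var_mem : ∀ i l, l ≠ 1 → l ≠ g → gradedVar K i l ∈ I
  lie_mem : ∀ a ∈ freeComponent K g, ∀ b ∈ freeComponent K g, ⁅a, b⁆ ∈ I
  metabelian : ∀ a ∈ freeComponent K (1 : G), ∀ b ∈ freeComponent K (1 : G),
    ∀ c ∈ freeComponent K (1 : G), ∀ d ∈ freeComponent K (1 : G), ⁅⁅a, b⁆, ⁅c, d⁆⁆ ∈ I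
  nilpotent : ∀ w ∈ freeComponent K g, ∀ a ∈ freeComponent K (1 : G),
    ∀ b ∈ freeComponent K (1 : G), ∀ c ∈ freeComponent K (1 : G),
    ∀ d ∈ freeComponent K (1 : G), ⁅⁅w, ⁅a, b⁆⁆, ⁅c, d⁆⁆ ∈ I

theorem IsTGIdeal.gradedSubst_mem {I : LieIdeal K (FreeLieAlgebra K (ℕ × G))} (hI : IsTGIdeal I)
    {a b : ℕ → FreeLieAlgebra K (ℕ × G)} (ha : ∀ i, a i ∈ freeComponent K (1 : G))
    (hb : ∀ i, b i ∈ freeComponent K g) {f : FreeLieAlgebra K (ℕ × G)} (hf : f ∈ I) :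
    gradedSubst g a b (gradedVar K) f ∈ I :=
  hI _ (_root_.gradedSubst_mem a b _ ha hb gradedVar_mem_freeComponent) f hf

theorem containsGradedRelations_tgIdealSpan (hg : g ≠ 1) :
    ContainsGradedRelations g (tgIdealSpan (gradedGenerators K g)) := by
  have hI := isTGIdeal_tgIdealSpan (gradedGenerators K g)
  have h0 : ∀ h : G, (0 : FreeLieAlgebra K (ℕ × G)) ∈ freeComponent K h := fun h => zero_mem _
  refine ⟨?_, ?_, ?_, ?_⟩
  · intro i l h₁ h₂
    have h := subset_tgIdealSpan (K := K) (S := gradedGenerators K g) (f := gradedVar K 1 l)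
      (Or.inl ⟨l, h₁, h₂, rfl⟩)
    -- Only the variables with index 1 are generators; this substitution sends x_{1,l} to x_{i,l}.
    have := hI (gradedSubst g (fun j => gradedVar K j 1) (fun j => gradedVar K j g)
      fun _ h => gradedVar K i h) (gradedSubst_mem _ _ _
        (fun j => gradedVar_mem_freeComponent j 1) (fun j => gradedVar_mem_freeComponent j g)
        fun _ h => gradedVar_mem_freeComponent i h) _ h
    simpa [gradedSubst, gradedVar, h₁, h₂] using this
  · intro a ha b hb
    have h := subset_tgIdealSpan (K := K) (S := gradedGenerators K g)
      (f := ⁅gradedVar K 1 g, gradedVar K 2 g⁆) (by simp [gradedGenerators, -lie_lie])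
    have := hI.gradedSubst_mem (g := g) (a := fun _ => 0) (b := fun i => if i = 1 then a else b)
      (fun _ => h0 _) (fun i => by split_ifs <;> assumption) h
    simpa [gradedSubst_self _ _ _ hg, -lie_lie] using this
  · intro a ha b hb c hc d hd
    have h := subset_tgIdealSpan (K := K) (S := gradedGenerators K g)
      (f := ⁅⁅gradedVar K 1 (1 : G), gradedVar K 2 (1 : G)⁆, ⁅gradedVar K 3 (1 : G), gradedVar K 4 (1 : G)⁆⁆)
      (by simp [gradedGenerators, -lie_lie])
    have := hI.gradedSubst_mem (g := g)
      (a := fun i => if i = 1 then a else if i = 2 then b else if i = 3 then c else d)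
      (b := fun _ => 0) (fun i => by split_ifs <;> assumption) (fun _ => h0 _) h
    simpa [-lie_lie] using this
  · intro w hw a ha b hb c hc d hd
    have h := subset_tgIdealSpan (K := K) (S := gradedGenerators K g)
      (f := ⁅⁅gradedVar K 1 g, ⁅gradedVar K 2 (1 : G), gradedVar K 3 (1 : G)⁆⁆,
        ⁅gradedVar K 4 (1 : G), gradedVar K 5 (1 : G)⁆⁆)
      (by simp [gradedGenerators, -lie_lie])
    have := hI.gradedSubst_mem (g := g)
      (a := fun i => if i = 2 then a else if i = 3 then b else if i = 4 then c else d)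
      (b := fun _ => w) (fun i => by split_ifs <;> assumption) (fun _ => hw) h
    simpa [gradedSubst_self _ _ _ hg, -lie_lie] using this

/-- Brackets of elements of degree 1 lie in K e_23, whence the metabelian law. Two successive
brackets with e_23 take e_12 to e_13 and then to 0, whence the last generator. -/
theorem tgIdealSpan_gradedGenerators_le (hg : g ≠ 1) :
    tgIdealSpan (gradedGenerators K g) ≤ gradedIdentities (elementaryGrading K g 1) := by
  refine tgIdealSpan_le
    (isTGIdeal_gradedIdentities fun h k a b ha hb => lie_mem_elementaryGrading hg ha hb) ?_
  have e₁ : ∀ φ : FreeLieAlgebra K (ℕ × G) →ₗ⁅K⁆ UT 3 K,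
      (∀ i h, φ (gradedVar K i h) ∈ elementaryGrading K g 1 h) → ∀ i,
      (φ (gradedVar K i 1)).1 0 1 = 0 ∧ (φ (gradedVar K i 1)).1 0 2 = 0 := fun φ hφ i =>
    (mem_elementaryGrading_one hg).1 (hφ i 1)
  have e₂ : ∀ φ : FreeLieAlgebra K (ℕ × G) →ₗ⁅K⁆ UT 3 K,
      (∀ i h, φ (gradedVar K i h) ∈ elementaryGrading K g 1 h) → ∀ i,
      (φ (gradedVar K i g)).1 0 0 = 0 ∧ (φ (gradedVar K i g)).1 1 1 = 0 ∧
        (φ (gradedVar K i g)).1 1 2 = 0 ∧ (φ (gradedVar K i g)).1 2 2 = 0 := fun φ hφ i =>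
    (mem_elementaryGrading_self hg).1 (hφ i g)
  rintro f (⟨l, h₁, h₂, rfl⟩ | rfl | rfl | rfl) <;> refine mem_gradedIdentities.2 fun φ hφ => ?_
  · exact (mem_elementaryGrading_of_ne h₁ h₂).1 (hφ 1 l)
  all_goals
    apply UT.ext_three <;>
      simp [-LieSubalgebra.coe_bracket, -lie_lie, UT.lie_apply_three, e₁ φ hφ, e₂ φ hφ]

end GradedIdeals

/-! ### The family spans modulo the generated ideal. -/

section Spanning

variable {K : Type*} [Field K] {G : Type*} [Group G] {g : G}

theorem one_le_of_isMonomialOfLength {n : ℕ} {a : FreeLieAlgebra K ℕ}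
    (h : IsMonomialOfLength K n a) : 1 ≤ n := by
  induction h with
  | of_var i => exact le_rfl
  | of_lie m n a b _ _ hm hn => omega

theorem lengthComponent_le_span {n : ℕ} (hn : n < 2) :
    lengthComponent K n ≤ Submodule.span K (Set.range (FreeLieAlgebra.of K)) := by
  rw [lengthComponent, Submodule.span_le]
  intro a (ha : IsMonomialOfLength K n a)
  cases ha with
  | of_var i => exact Submodule.subset_span (Set.mem_range_self i)
  | of_lie m n a b hm hn' =>
    have := one_le_of_isMonomialOfLength hm
    have := one_le_of_isMonomialOfLength hn'
    omega

theorem lengthComponent_le_bracketSpan {n : ℕ} (hn : 2 ≤ n) :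
    lengthComponent K n ≤ bracketSpan K (FreeLieAlgebra K ℕ) := by
  rw [lengthComponent, Submodule.span_le]
  intro a (ha : IsMonomialOfLength K n a)
  cases ha with
  | of_var i => omega
  | of_lie m n a b hm hn' => exact lie_mem_bracketSpan a b

/-- The elements of `B` of length at least two. -/
def longPart (B : Set (FreeLieAlgebra K ℕ)) : Set (FreeLieAlgebra K ℕ) :=
  {m | m ∈ B ∧ ∃ n, 2 ≤ n ∧ m ∈ lengthComponent K n}

theorem longPart_subset_bracketSpan (B : Set (FreeLieAlgebra K ℕ)) :
    longPart B ⊆ (bracketSpan K (FreeLieAlgebra K ℕ) : Set (FreeLieAlgebra K ℕ)) := by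
  rintro m ⟨-, n, hn, hm⟩
  exact lengthComponent_le_bracketSpan hn hm

theorem IsBasisModulo.mem_span_sup {L ι : Type*} [LieRing L] [LieAlgebra K L] {I : LieIdeal K L}
    {v : ι → L} (h : IsBasisModulo I v) (f : L) :
    f ∈ Submodule.span K (Set.range v) ⊔ I.toSubmodule := by
  let π : L →ₗ[K] L ⧸ I := (LieSubmodule.Quotient.mk' I : L →ₗ[K] L ⧸ I)
  have h₁ : π f ∈ Submodule.map π (Submodule.span K (Set.range v)) := by
    rw [Submodule.map_span, ← Set.range_comp]
    exact (h.2 ▸ Submodule.mem_top :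
      π f ∈ Submodule.span K (Set.range fun i => (LieSubmodule.Quotient.mk (v i) : L ⧸ I)))
  obtain ⟨x, hx, hxf⟩ := h₁
  rw [← add_sub_cancel x f]
  refine Submodule.add_mem_sup hx ?_
  have : π (f - x) = 0 := by rw [map_sub, hxf, sub_self]
  exact (LieSubmodule.Quotient.mk_eq_zero I).1 this

section Ordinary

variable {B : Set (FreeLieAlgebra K ℕ)}

theorem mem_span_longPart (hB : ∀ m ∈ B, ∃ n, m ∈ lengthComponent K n)
    (hbasis : IsBasisModulo (identities K (UT 2 K)) (fun m : B => (m : FreeLieAlgebra K ℕ)))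
    (f : FreeLieAlgebra K ℕ) :
    f ∈ Submodule.span K (Set.range (FreeLieAlgebra.of K)) ⊔
      (Submodule.span K (longPart B) ⊔ (identities K (UT 2 K)).toSubmodule) := by
  suffices h : Submodule.span K (Set.range fun m : B => (m : FreeLieAlgebra K ℕ)) ≤
      Submodule.span K (Set.range (FreeLieAlgebra.of K)) ⊔
        (Submodule.span K (longPart B) ⊔ (identities K (UT 2 K)).toSubmodule) from
    sup_le h (le_sup_right.trans le_sup_right) (hbasis.mem_span_sup f)
  rw [Submodule.span_le]
  rintro _ ⟨⟨m, hm⟩, rfl⟩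
  obtain ⟨n, hn⟩ := hB m hm
  rcases lt_or_ge n 2 with h | h
  · exact Submodule.mem_sup_left (lengthComponent_le_span h hn)
  · exact Submodule.mem_sup_right (Submodule.mem_sup_left
      (Submodule.subset_span ⟨hm, n, h, hn⟩))

/-- Diagonal evaluations separate linear forms in the y_i from the derived algebra, so the
length-one part of the expansion of a bracket vanishes. -/
theorem bracketSpan_le_span_longPart (hB : ∀ m ∈ B, ∃ n, m ∈ lengthComponent K n)
    (hbasis : IsBasisModulo (identities K (UT 2 K)) (fun m : B => (m : FreeLieAlgebra K ℕ))) :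
    bracketSpan K (FreeLieAlgebra K ℕ) ≤
      Submodule.span K (longPart B) ⊔ (identities K (UT 2 K)).toSubmodule := by
  intro d hd
  obtain ⟨a, ha, r, hr, rfl⟩ := Submodule.mem_sup.1 (mem_span_longPart hB hbasis d)
  obtain ⟨b, hb, n, hn, rfl⟩ := Submodule.mem_sup.1 hr
  have hb' : b ∈ bracketSpan K (FreeLieAlgebra K ℕ) :=
    Submodule.span_le.2 (longPart_subset_bracketSpan B) hb
  have : a = 0 := by
    refine eq_zero_of_mem_span_of ha (sub_mem hb' hd) ?_
    rw [show a + (b - (a + (b + n))) = -n by abel]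
    exact neg_mem hn
  rwa [this, zero_add]

end Ordinary

namespace ContainsGradedRelations

variable {I : LieIdeal K (FreeLieAlgebra K (ℕ × G))}

/-- The preimage of I in L(Y) contains every [[a, b], [c, d]] and lies in Id(UT_2), so it equals
Id(UT_2). -/
theorem inclY_mem [Infinite K] (hI : ContainsGradedRelations g I) (hg : g ≠ 1)
    (hle : I ≤ gradedIdentities (elementaryGrading K g 1)) {f : FreeLieAlgebra K ℕ}
    (hf : f ∈ identities K (UT 2 K)) : inclY K G f ∈ I := by
  have := identities_le_of_lie_lie_mem (N := I.comap (inclY K G)) (fun a b c d => ?_)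
    (fun f hf => inclY_mem_gradedIdentities hg (hle hf)) hf
  · exact this
  · rw [LieIdeal.mem_comap]
    simp only [LieHom.map_lie]
    exact hI.metabelian _ (inclY_mem_freeComponent a) _ (inclY_mem_freeComponent b)
      _ (inclY_mem_freeComponent c) _ (inclY_mem_freeComponent d)

/-- `[w, u, v] ∈ I` for `w` of degree `g` and `u`, `v` in the derived algebra of `L(Y)`. -/
theorem lie_lie_inclY_mem (hI : ContainsGradedRelations g I) {w : FreeLieAlgebra K (ℕ × G)}
    (hw : w ∈ freeComponent K g) {u v : FreeLieAlgebra K ℕ}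
    (hu : u ∈ bracketSpan K (FreeLieAlgebra K ℕ)) (hv : v ∈ bracketSpan K (FreeLieAlgebra K ℕ)) :
    ⁅⁅w, inclY K G u⁆, inclY K G v⁆ ∈ I := by
  induction hu using Submodule.span_induction with
  | mem u hu =>
    obtain ⟨a, b, rfl⟩ := hu
    induction hv using Submodule.span_induction with
    | mem v hv =>
      obtain ⟨c, d, rfl⟩ := hv
      simp only [LieHom.map_lie]
      exact hI.nilpotent w hw _ (inclY_mem_freeComponent a) _ (inclY_mem_freeComponent b)
        _ (inclY_mem_freeComponent c) _ (inclY_mem_freeComponent d)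
    | zero => rw [map_zero, lie_zero]; exact zero_mem _
    | add a b _ _ ha hb => rw [map_add, lie_add]; exact add_mem ha hb
    | smul r a _ ha => rw [map_smul, lie_smul]; exact I.smul_mem r ha
  | zero => rw [map_zero, lie_zero, zero_lie]; exact zero_mem _
  | add a b _ _ ha hb => rw [map_add, lie_add, add_lie]; exact add_mem ha hb
  | smul r a _ ha => rw [map_smul, lie_smul, smul_lie]; exact I.smul_mem r ha

/-- The elements `w` with `[w, u] ∈ P` for all `u` in the derived algebra of `L(Y)`. -/
def derivedTransporter (P : Submodule K (FreeLieAlgebra K (ℕ × G))) :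
    Set (FreeLieAlgebra K (ℕ × G)) :=
  {w | ∀ u ∈ bracketSpan K (FreeLieAlgebra K ℕ), ⁅w, inclY K G u⁆ ∈ P}

/-- By Jacobi, [w, y, u] = [w, [y, u]] + [w, u, y], and [y, u] is again in the derived algebra. -/
theorem lie_mem_derivedTransporter {P : Submodule K (FreeLieAlgebra K (ℕ × G))}
    (hP : ∀ w ∈ P, ∀ i, ⁅w, gradedVar K i (1 : G)⁆ ∈ P) :
    ∀ w ∈ derivedTransporter P, ∀ i, ⁅w, gradedVar K i (1 : G)⁆ ∈ derivedTransporter P := by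
  intro w hw i u hu
  rw [← sub_add_cancel ⁅⁅w, gradedVar K i (1 : G)⁆, inclY K G u⁆
    ⁅⁅w, inclY K G u⁆, gradedVar K i (1 : G)⁆, lie_lie_sub_lie_lie, ← inclY_of,
    ← LieHom.map_lie]
  refine add_mem (hw _ (lie_mem_bracketSpan _ _)) ?_
  rw [inclY_of]
  exact hP _ (hw u hu) i

/-- On the transporter of P the operators [·, y_i] commute modulo P, so an appended y_i can be
sorted into the tail. -/
theorem lieTail_lie_sub_mem {P : Submodule K (FreeLieAlgebra K (ℕ × G))}
    (hP : ∀ w ∈ P, ∀ i, ⁅w, gradedVar K i (1 : G)⁆ ∈ P) {w : FreeLieAlgebra K (ℕ × G)}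
    (hw : w ∈ derivedTransporter P) (k : ℕ →₀ ℕ) (i : ℕ) :
    ⁅lieTail w k, gradedVar K i (1 : G)⁆ - lieTail w (k + Finsupp.single i 1) ∈ P := by
  rw [lieTail_eq_lieWord, lieTail_eq_lieWord, ← lieWord_concat]
  refine lieWord_sub_lieWord_mem_of_perm (lie_mem_derivedTransporter hP) hP ?_
    (exponentList_concat_perm k i).symm hw
  intro w hw i j
  rw [lie_lie_sub_lie_lie, ← inclY_of, ← inclY_of, ← LieHom.map_lie]
  exact hw _ (lie_mem_bracketSpan _ _)

theorem lieTail_zero (w : FreeLieAlgebra K (ℕ × G)) : lieTail w 0 = w := by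
  simp [lieTail]

theorem lieTail_mem_freeComponent {w : FreeLieAlgebra K (ℕ × G)} (hw : w ∈ freeComponent K g)
    (k : ℕ →₀ ℕ) : lieTail w k ∈ freeComponent K g := by
  rw [lieTail_eq_lieWord]
  refine lieWord_mem (C := (freeComponent K g : Set (FreeLieAlgebra K (ℕ × G))))
    (fun w hw i => ?_) hw (exponentList k)
  have := lie_mem_freeComponent hw (gradedVar_mem_freeComponent (K := K) i (1 : G))
  rwa [mul_one] at this

/-- The span of the commutators of type 2, modulo `I`. -/
noncomputable def typeTwoSpan (g : G) (B : Set (FreeLieAlgebra K ℕ))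
    (I : LieIdeal K (FreeLieAlgebra K (ℕ × G))) : Submodule K (FreeLieAlgebra K (ℕ × G)) :=
  Submodule.span K (Set.range (typeTwo g B)) ⊔ I.toSubmodule

/-- The span of the commutators of types 1 and 2, modulo `I`. -/
noncomputable def typeOneSpan (g : G) (B : Set (FreeLieAlgebra K ℕ))
    (I : LieIdeal K (FreeLieAlgebra K (ℕ × G))) : Submodule K (FreeLieAlgebra K (ℕ × G)) :=
  Submodule.span K (Set.range (typeOne K g)) ⊔ typeTwoSpan g B I

/-- The relation [z, u, v] ∈ I for u, v in the derived algebra puts [m, z_j] in the transporter of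
I, so type 2 tails can be sorted modulo I. -/
theorem lie_mem_typeTwoSpan (hI : ContainsGradedRelations g I) (B : Set (FreeLieAlgebra K ℕ)) :
    ∀ w ∈ typeTwoSpan g B I, ∀ i, ⁅w, gradedVar K i (1 : G)⁆ ∈ typeTwoSpan g B I := by
  intro w hw i
  rw [← lieRight_apply (K := K), ← Submodule.mem_comap]
  suffices h : typeTwoSpan g B I ≤ (typeTwoSpan g B I).comap (lieRight K (gradedVar K i 1)) from
    h hw
  have hP : ∀ w ∈ I.toSubmodule, ∀ i, ⁅w, gradedVar K i (1 : G)⁆ ∈ I.toSubmodule :=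
    fun w hw i => lie_mem_left K _ I _ _ hw
  refine sup_le (Submodule.span_le.2 ?_) fun w hw => ?_
  · rintro _ ⟨⟨m, j, k⟩, rfl⟩
    rw [SetLike.mem_coe, Submodule.mem_comap, lieRight_apply, typeTwo]
    have hw : ⁅inclY K G m.1, gradedVar K j g⁆ ∈ derivedTransporter I.toSubmodule := by
      intro u hu
      rw [← lie_skew (inclY K G m.1), neg_lie]
      exact neg_mem (hI.lie_lie_inclY_mem (gradedVar_mem_freeComponent j g)
        (longPart_subset_bracketSpan B m.2) hu)
    rw [← sub_add_cancel ⁅lieTail _ _, _⁆]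
    refine add_mem (Submodule.mem_sup_right (lieTail_lie_sub_mem hP hw k i))
      (Submodule.mem_sup_left (Submodule.subset_span ⟨(m, j, k + Finsupp.single i 1), rfl⟩))
  · rw [Submodule.mem_comap, lieRight_apply]
    exact Submodule.mem_sup_right (hP w hw i)

variable {B : Set (FreeLieAlgebra K ℕ)}

theorem inclY_lie_mem_typeTwoSpan [Infinite K] (hI : ContainsGradedRelations g I) (hg : g ≠ 1)
    (hle : I ≤ gradedIdentities (elementaryGrading K g 1)) (j : ℕ) {f : FreeLieAlgebra K ℕ}
    (hf : f ∈ Submodule.span K (longPart B) ⊔ (identities K (UT 2 K)).toSubmodule) :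
    ⁅inclY K G f, gradedVar K j g⁆ ∈ typeTwoSpan g B I := by
  suffices h : Submodule.span K (longPart B) ⊔ (identities K (UT 2 K)).toSubmodule ≤
      (typeTwoSpan g B I).comap
        ((lieRight K (gradedVar K j g)).comp (inclY K G).toLinearMap) by
    simpa using h hf
  refine sup_le (Submodule.span_le.2 fun m hm => ?_) fun f hf => ?_
  · refine Submodule.mem_sup_left (Submodule.subset_span ⟨(⟨m, hm⟩, j, 0), ?_⟩)
    simp [typeTwo, lieTail_zero]
  · refine Submodule.mem_sup_right ?_
    simp only [LinearMap.comp_apply, lieRight_apply]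
    exact lie_mem_left K _ I _ _ (hI.inclY_mem hg hle hf)

/-- Sorting a type 1 tail produces errors built from [z_j, u] with u in the derived algebra;
expanding u in the long elements of B makes these type 2. -/
theorem lie_mem_typeOneSpan [Infinite K] (hI : ContainsGradedRelations g I) (hg : g ≠ 1)
    (hle : I ≤ gradedIdentities (elementaryGrading K g 1))
    (hB : bracketSpan K (FreeLieAlgebra K ℕ) ≤
      Submodule.span K (longPart B) ⊔ (identities K (UT 2 K)).toSubmodule) :
    ∀ w ∈ typeOneSpan g B I, ∀ i, ⁅w, gradedVar K i (1 : G)⁆ ∈ typeOneSpan g B I := by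
  intro w hw i
  rw [← lieRight_apply (K := K), ← Submodule.mem_comap]
  suffices h : typeOneSpan g B I ≤ (typeOneSpan g B I).comap (lieRight K (gradedVar K i 1)) from
    h hw
  refine sup_le (Submodule.span_le.2 ?_) fun w hw => ?_
  · rintro _ ⟨⟨j, k⟩, rfl⟩
    rw [SetLike.mem_coe, Submodule.mem_comap, lieRight_apply, typeOne]
    have hw : gradedVar K j g ∈ derivedTransporter (typeTwoSpan g B I) := by
      intro u hu
      rw [← lie_skew]
      exact neg_mem (hI.inclY_lie_mem_typeTwoSpan hg hle j (hB hu))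
    rw [← sub_add_cancel ⁅lieTail _ _, _⁆]
    exact add_mem
      (Submodule.mem_sup_right (lieTail_lie_sub_mem (hI.lie_mem_typeTwoSpan B) hw k i))
      (Submodule.mem_sup_left (Submodule.subset_span ⟨(j, k + Finsupp.single i 1), rfl⟩))
  · rw [Submodule.mem_comap, lieRight_apply]
    exact Submodule.mem_sup_right (hI.lie_mem_typeTwoSpan B w hw i)

/-- Used to see that bracketing this span with a variable z_j lands in I. -/
theorem typeOneSpan_le (g : G) (B : Set (FreeLieAlgebra K ℕ))
    (I : LieIdeal K (FreeLieAlgebra K (ℕ × G))) :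
    typeOneSpan g B I ≤ freeComponent K g ⊔ I.toSubmodule := by
  refine sup_le ((Submodule.span_le.2 ?_).trans le_sup_left)
    (sup_le_sup_right (Submodule.span_le.2 ?_) _)
  · rintro _ ⟨⟨j, k⟩, rfl⟩
    exact lieTail_mem_freeComponent (gradedVar_mem_freeComponent j g) k
  · rintro _ ⟨⟨m, j, k⟩, rfl⟩
    refine lieTail_mem_freeComponent ?_ k
    have := lie_mem_freeComponent (inclY_mem_freeComponent (G := G) m.1)
      (gradedVar_mem_freeComponent (K := K) j g)
    rwa [one_mul] at this

theorem mem_inclY_sup_typeOneSpan [Infinite K] (hI : ContainsGradedRelations g I) (hg : g ≠ 1)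
    (hle : I ≤ gradedIdentities (elementaryGrading K g 1))
    (hB : ∀ m ∈ B, ∃ n, m ∈ lengthComponent K n)
    (hbasis : IsBasisModulo (identities K (UT 2 K)) (fun m : B => (m : FreeLieAlgebra K ℕ)))
    (f : FreeLieAlgebra K (ℕ × G)) :
    f ∈ LinearMap.range (inclY K G).toLinearMap ⊔ typeOneSpan g B I := by
  have hy := hI.lie_mem_typeOneSpan hg hle (bracketSpan_le_span_longPart hB hbasis)
  have hz : ∀ j, gradedVar K j g ∈ typeOneSpan g B I := fun j =>
    Submodule.mem_sup_left (Submodule.subset_span ⟨(j, 0), by simp [typeOne, lieTail_zero]⟩)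
  have hle' : I.toSubmodule ≤ typeOneSpan g B I := le_sup_right.trans le_sup_right
  refine FreeLieAlgebra.mem_of_forall_lie_of_mem _ ?_ ?_ f
  · rintro ⟨i, h⟩
    by_cases h₁ : h = 1
    · subst h₁
      exact Submodule.mem_sup_left ⟨FreeLieAlgebra.of K i, inclY_of i⟩
    by_cases h₂ : h = g
    · subst h₂
      exact Submodule.mem_sup_right (hz i)
    · exact Submodule.mem_sup_right (hle' (hI.var_mem i h h₁ h₂))
  · rintro a ha ⟨i, h⟩
    change ⁅a, gradedVar K i h⁆ ∈ _
    by_cases h₁ : h = 1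
    · subst h₁
      obtain ⟨_, ⟨b, rfl⟩, w, hw, rfl⟩ := Submodule.mem_sup.1 ha
      rw [add_lie]
      refine Submodule.add_mem_sup ⟨⁅b, FreeLieAlgebra.of K i⁆, ?_⟩ (hy w hw i)
      simp
    refine Submodule.mem_sup_right ?_
    by_cases h₂ : h = g
    · subst h₂
      obtain ⟨_, ⟨b, rfl⟩, w, hw, rfl⟩ := Submodule.mem_sup.1 ha
      rw [add_lie]
      refine add_mem ?_ ?_
      -- The linear part of b gives [y_s, z] = -[z, y_s], of type 1 up to sign; the rest gives type
      -- 2 commutators modulo I.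
      · obtain ⟨c, hc, d, hd, rfl⟩ := Submodule.mem_sup.1 (mem_span_longPart hB hbasis b)
        rw [map_add, add_lie]
        refine add_mem ?_ (Submodule.mem_sup_right (hI.inclY_lie_mem_typeTwoSpan hg hle i hd))
        suffices h : Submodule.span K (Set.range (FreeLieAlgebra.of K)) ≤
            (typeOneSpan h B I).comap
              ((lieRight K (gradedVar K i h)).comp (inclY K G).toLinearMap) by
          simpa using h hc
        rw [Submodule.span_le]
        rintro _ ⟨s, rfl⟩
        rw [SetLike.mem_coe, Submodule.mem_comap, LinearMap.comp_apply, lieRight_apply]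
        change ⁅inclY K G (FreeLieAlgebra.of K s), _⁆ ∈ _
        rw [inclY_of, ← lie_skew]
        exact neg_mem (hy _ (hz i) s)
      · obtain ⟨c, hc, d, hd, rfl⟩ := Submodule.mem_sup.1 (typeOneSpan_le h B I hw)
        rw [add_lie]
        exact hle' (add_mem (hI.lie_mem c hc _ (gradedVar_mem_freeComponent i h))
          (lie_mem_left K _ I _ _ hd))
    · exact hle' (lie_mem_right K _ I _ _ (hI.var_mem i h h₁ h₂))

theorem mem_span_family_sup [Infinite K] (hI : ContainsGradedRelations g I) (hg : g ≠ 1)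
    (hle : I ≤ gradedIdentities (elementaryGrading K g 1))
    (hB : ∀ m ∈ B, ∃ n, m ∈ lengthComponent K n)
    (hbasis : IsBasisModulo (identities K (UT 2 K)) (fun m : B => (m : FreeLieAlgebra K ℕ)))
    (f : FreeLieAlgebra K (ℕ × G)) :
    f ∈ Submodule.span K (Set.range (Sum.elim
        (fun m : B => inclY K G (m : FreeLieAlgebra K ℕ))
        (Sum.elim (typeOne K g) (typeTwo g B)))) ⊔ I.toSubmodule := by
  refine (sup_le ?_ ?_ : LinearMap.range (inclY K G).toLinearMap ⊔ typeOneSpan g B I ≤ _)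
    (hI.mem_inclY_sup_typeOneSpan hg hle hB hbasis f)
  · rintro _ ⟨b, rfl⟩
    obtain ⟨c, hc, d, hd, rfl⟩ := Submodule.mem_sup.1 (hbasis.mem_span_sup b)
    rw [map_add]
    refine Submodule.add_mem_sup ?_ (hI.inclY_mem hg hle hd)
    have := Submodule.mem_map_of_mem (f := (inclY K G).toLinearMap) hc
    rw [Submodule.map_span, ← Set.range_comp] at this
    refine Submodule.span_mono ?_ this
    rintro _ ⟨m, rfl⟩
    exact ⟨Sum.inl m, rfl⟩
  · rw [Set.Sum.elim_range, Set.Sum.elim_range, Submodule.span_union, Submodule.span_union, sup_assoc,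
      sup_assoc]
    exact le_sup_right

end ContainsGradedRelations

end Spanning

/-! ### The family is independent modulo the graded identities. -/

section Independence

variable {K : Type*} [Field K]

/-- The homomorphism `f ↦ χ(f) + λ(f) · 1`, where `λ` is the linear functional that vanishes on
brackets and takes the values `s_i` at the generators. -/
noncomputable def scalarTwist (χ : FreeLieAlgebra K ℕ →ₗ⁅K⁆ UT 2 K) (s : ℕ → K) :
    FreeLieAlgebra K ℕ →ₗ⁅K⁆ UT 2 K :=
  { χ.toLinearMap + ((UT.entry K 1 1).comp (affineEval 0 s).toLinearMap).smulRight
      (UT.mkTwo 1 0 1) with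
    map_lie' := by
      intro f h
      apply UT.ext_two <;>
        simp [-LieSubalgebra.coe_bracket, UT.lie_apply_two, UT.mkTwo] }

theorem scalarTwist_apply (χ : FreeLieAlgebra K ℕ →ₗ⁅K⁆ UT 2 K) (s : ℕ → K)
    (f : FreeLieAlgebra K ℕ) :
    scalarTwist χ s f = χ f + (affineEval 0 s f).1 1 1 • UT.mkTwo 1 0 1 := rfl

theorem scalarTwist_of_one_one (χ : FreeLieAlgebra K ℕ →ₗ⁅K⁆ UT 2 K) (s : ℕ → K) (i : ℕ) :
    (scalarTwist χ s (FreeLieAlgebra.of K i)).1 1 1 = (χ (FreeLieAlgebra.of K i)).1 1 1 + s i := by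
  simp [scalarTwist_apply, affineEval, UT.mkTwo]

theorem scalarTwist_apply_zero_one (χ : FreeLieAlgebra K ℕ →ₗ⁅K⁆ UT 2 K) (s : ℕ → K)
    (f : FreeLieAlgebra K ℕ) : (scalarTwist χ s f).1 0 1 = (χ f).1 0 1 := by
  simp [scalarTwist_apply, UT.mkTwo]

theorem exists_linearMap_quotient {L N : Type*} [LieRing L] [LieAlgebra K L] [AddCommGroup N]
    [Module K N] (I : LieIdeal K L) (T : L →ₗ[K] N) (h : ∀ x ∈ I, T x = 0) :
    ∃ T' : (L ⧸ I) →ₗ[K] N, ∀ x, T' (LieSubmodule.Quotient.mk x) = T x :=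
  ⟨I.toSubmodule.liftQ T h, fun _ => rfl⟩

theorem linearIndependent_coordinates (K ι : Type*) [Field K] :
    LinearIndependent K (fun (j : ι) (p : ι → K) => p j) := by
  classical
  rw [linearIndependent_iff']
  intro s c hc j hj
  have := congrFun hc (Pi.single j 1)
  simpa [Finset.sum_apply, Pi.single_apply, hj] using this

/-- The elements of `B` of length at least two, as an index type. -/
abbrev LongIndex (B : Set (FreeLieAlgebra K ℕ)) : Type _ :=
  {m // m ∈ B ∧ ∃ n, 2 ≤ n ∧ m ∈ lengthComponent K n}

/-- Long elements have zero diagonal under every χ, so a combination whose e_12 entry always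
vanishes is an identity of UT_2. -/
theorem linearIndependent_apply_zero_one {B : Set (FreeLieAlgebra K ℕ)}
    (hbasis : IsBasisModulo (identities K (UT 2 K)) (fun m : B => (m : FreeLieAlgebra K ℕ))) :
    LinearIndependent K (fun (m : LongIndex B) (χ : FreeLieAlgebra K ℕ →ₗ⁅K⁆ UT 2 K) =>
      (χ (m : FreeLieAlgebra K ℕ)).1 0 1) := by
  have h : LinearIndependent K (fun m : LongIndex B =>
      (LieSubmodule.Quotient.mk (m : FreeLieAlgebra K ℕ) :
        FreeLieAlgebra K ℕ ⧸ identities K (UT 2 K))) :=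
    hbasis.1.comp (fun m : LongIndex B => (⟨m, m.2.1⟩ : B))
      fun m m' hm => Subtype.ext (congrArg (fun b : B => (b : FreeLieAlgebra K ℕ)) hm)
  rw [linearIndependent_iff'] at h ⊢
  intro s c hc
  refine h s c ?_
  have hx : ∑ m ∈ s, c m • (m : FreeLieAlgebra K ℕ) ∈ identities K (UT 2 K) := by
    refine mem_identities.2 fun χ => ?_
    have hd : ∑ m ∈ s, c m • (m : FreeLieAlgebra K ℕ) ∈ bracketSpan K (FreeLieAlgebra K ℕ) :=
      Submodule.sum_mem _ fun m _ => Submodule.smul_mem _ _ (longPart_subset_bracketSpan B m.2)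
    obtain ⟨h₀, h₁⟩ := apply_diag_of_mem_bracketSpan χ hd
    refine UT.ext_two h₀ ?_ h₁
    have := congrFun hc χ
    rw [← UT.entry_apply, map_sum, map_sum]
    simpa [Finset.sum_apply] using this
  have := (LieSubmodule.Quotient.mk_eq_zero (identities K (UT 2 K))).2 hx
  rw [map_sum] at this
  exact this

variable {G : Type*} [Group G] {g : G}

theorem blockEval_lieTail (χ : FreeLieAlgebra K ℕ →ₗ⁅K⁆ UT 2 K) (p : ℕ → K)
    (w : FreeLieAlgebra K (ℕ × G)) (k : ℕ →₀ ℕ) :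
    blockEval g χ p (lieTail w k) =
      lieWord (fun i => UT.block K (χ (FreeLieAlgebra.of K i))) (blockEval g χ p w)
        (exponentList k) := by
  rw [lieTail_eq_lieWord, map_lieWord]
  simp [blockEval]

theorem blockEval_self (hg : g ≠ 1) (χ : FreeLieAlgebra K ℕ →ₗ⁅K⁆ UT 2 K) (p : ℕ → K) (j : ℕ) :
    blockEval g χ p (gradedVar K j g) = UT.row (p j) := by
  rw [blockEval, gradedSubst_self _ _ _ hg]

theorem blockEval_typeOne (hg : g ≠ 1) (χ : FreeLieAlgebra K ℕ →ₗ⁅K⁆ UT 2 K) (p : ℕ → K)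
    (q : ℕ × (ℕ →₀ ℕ)) :
    (blockEval g χ p (typeOne K g q)).1 0 1 =
      p q.1 * q.2.prod fun i n => (χ (FreeLieAlgebra.of K i)).1 0 0 ^ n := by
  rw [typeOne, blockEval_lieTail, blockEval_self hg, lieWord_row _ (by simp [UT.row_apply]),
    prod_map_exponentList]
  simp [UT.row_apply]

theorem blockEval_lie (hg : g ≠ 1) (χ : FreeLieAlgebra K ℕ →ₗ⁅K⁆ UT 2 K) (p : ℕ → K)
    {m : FreeLieAlgebra K ℕ} (hm : m ∈ bracketSpan K (FreeLieAlgebra K ℕ)) (j : ℕ) :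
    (blockEval g χ p ⁅inclY K G m, gradedVar K j g⁆).1 =
      !![0, 0, -(p j * (χ m).1 0 1); 0, 0, 0; 0, 0, 0] := by
  obtain ⟨h₀, h₁⟩ := apply_diag_of_mem_bracketSpan χ hm
  rw [LieHom.map_lie, blockEval_inclY, blockEval_self hg, UT.lie_apply_three]
  simp [UT.block_apply, UT.row_apply, h₀]

theorem blockEval_typeTwo_zero_one (hg : g ≠ 1) (χ : FreeLieAlgebra K ℕ →ₗ⁅K⁆ UT 2 K)
    (p : ℕ → K) {B : Set (FreeLieAlgebra K ℕ)} (q : LongIndex B × ℕ × (ℕ →₀ ℕ)) :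
    (blockEval g χ p (typeTwo g B q)).1 0 1 = 0 := by
  have h := blockEval_lie hg χ p (longPart_subset_bracketSpan B q.1.2) q.2.1
  rw [typeTwo, blockEval_lieTail, lieWord_row _ (by rw [h]; simp)]
  rw [h]
  simp

theorem blockEval_typeTwo_zero_two (hg : g ≠ 1) (χ : FreeLieAlgebra K ℕ →ₗ⁅K⁆ UT 2 K)
    (p : ℕ → K) {B : Set (FreeLieAlgebra K ℕ)} (q : LongIndex B × ℕ × (ℕ →₀ ℕ)) :
    (blockEval g χ p (typeTwo g B q)).1 0 2 =
      -((χ q.1).1 0 1 * (p q.2.1 *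
        q.2.2.prod fun i n => (χ (FreeLieAlgebra.of K i)).1 1 1 ^ n)) := by
  have h := blockEval_lie hg χ p (longPart_subset_bracketSpan B q.1.2) q.2.1
  rw [typeTwo, blockEval_lieTail, lieWord_row' _ (by rw [h]; simp) (by rw [h]; simp),
    prod_map_exponentList, h]
  simp
  ring

/-- The e_13 entry is a product of a function of χ, a coordinate of p and a monomial, but the
monomial's arguments also depend on χ. The scalar twist frees them and leaves the e_12 entry of χ(m)
unchanged, so the variables separate. -/
theorem linearIndependent_typeTwo [Infinite K] (hg : g ≠ 1) {B : Set (FreeLieAlgebra K ℕ)}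
    (hbasis : IsBasisModulo (identities K (UT 2 K)) (fun m : B => (m : FreeLieAlgebra K ℕ))) :
    LinearIndependent K (fun q => (LieSubmodule.Quotient.mk (typeTwo g B q) :
      FreeLieAlgebra K (ℕ × G) ⧸ gradedIdentities (elementaryGrading K g 1))) := by
  let T : FreeLieAlgebra K (ℕ × G) →ₗ[K]
      (((FreeLieAlgebra K ℕ →ₗ⁅K⁆ UT 2 K) × (ℕ → K) × (ℕ → K)) → K) :=
    -- The shift is chosen so that the second diagonal entry of the twisted χ(y_i) is exactly the
    -- free parameter `x.2.2 i`.
    LinearMap.pi fun x => -(UT.entry K 0 2).comp (blockEval g (scalarTwist x.1 fun i =>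
      x.2.2 i - (x.1 (FreeLieAlgebra.of K i)).1 1 1) x.2.1).toLinearMap
  obtain ⟨T', hT'⟩ := exists_linearMap_quotient (gradedIdentities (elementaryGrading K g 1)) T
    fun x hx => by
      funext y
      simp [T, blockEval_eq_zero hg _ _ hx]
  refine LinearIndependent.of_comp T' ?_
  have := (linearIndependent_apply_zero_one hbasis).mul_separate
    ((linearIndependent_coordinates K ℕ).mul_separate
      (MvPolynomial.linearIndependent_eval_monomial K ℕ))
  convert! this using 1
  funext q x
  rw [Function.comp_apply, hT']
  simp only [T, LinearMap.pi_apply, LinearMap.neg_apply, LinearMap.comp_apply, UT.entry_apply]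
  change -(blockEval g _ _ (typeTwo g B q)).1 0 2 = _
  rw [blockEval_typeTwo_zero_two hg, neg_neg]
  simp only [scalarTwist_apply_zero_one, scalarTwist_of_one_one, add_sub_cancel]

/-- The e_12 entry vanishes on type 2; with y_i ↦ t_i e_22 and z_j ↦ p_j e_12 it turns type 1 into
the independent functions p_j t^k. -/
theorem linearIndependent_typeOne_typeTwo [Infinite K] (hg : g ≠ 1)
    {B : Set (FreeLieAlgebra K ℕ)}
    (hbasis : IsBasisModulo (identities K (UT 2 K)) (fun m : B => (m : FreeLieAlgebra K ℕ))) :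
    LinearIndependent K (Sum.elim
      (fun q => (LieSubmodule.Quotient.mk (typeOne K g q) :
        FreeLieAlgebra K (ℕ × G) ⧸ gradedIdentities (elementaryGrading K g 1)))
      (fun q => LieSubmodule.Quotient.mk (typeTwo g B q))) := by
  let T : FreeLieAlgebra K (ℕ × G) →ₗ[K] (((ℕ → K) × (ℕ → K)) → K) :=
    LinearMap.pi fun x => (UT.entry K 0 1).comp
      (blockEval g (FreeLieAlgebra.lift K fun i => UT.mkTwo (x.2 i) 0 0) x.1).toLinearMap
  obtain ⟨T', hT'⟩ := exists_linearMap_quotient (gradedIdentities (elementaryGrading K g 1)) T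
    fun x hx => by
      funext y
      simp [T, blockEval_eq_zero hg _ _ hx]
  refine LinearIndependent.sumElim_of_comp T' ?_ (linearIndependent_typeTwo hg hbasis) ?_
  · have := (linearIndependent_coordinates K ℕ).mul_separate
      (MvPolynomial.linearIndependent_eval_monomial K ℕ)
    convert! this using 1
    funext q x
    rw [Function.comp_apply, hT']
    change (blockEval g _ _ (typeOne K g q)).1 0 1 = _
    rw [blockEval_typeOne hg]
    simp [UT.mkTwo]
  · intro q
    rw [hT']
    funext x
    exact blockEval_typeTwo_zero_one hg _ _ q

/-- Killing all variables of degree other than 1 retracts onto L(Y), annihilates types 1 and 2, and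
returns B, which is independent modulo Id(UT_2). -/
theorem linearIndependent_family [Infinite K] (hg : g ≠ 1) {B : Set (FreeLieAlgebra K ℕ)}
    (hbasis : IsBasisModulo (identities K (UT 2 K)) (fun m : B => (m : FreeLieAlgebra K ℕ))) :
    LinearIndependent K (fun q => (LieSubmodule.Quotient.mk
      (Sum.elim (fun m : B => inclY K G (m : FreeLieAlgebra K ℕ))
        (Sum.elim (typeOne K g) (typeTwo g B)) q) :
        FreeLieAlgebra K (ℕ × G) ⧸ gradedIdentities (elementaryGrading K g 1))) := by
  let π : FreeLieAlgebra K (ℕ × G) →ₗ⁅K⁆ FreeLieAlgebra K ℕ :=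
    gradedSubst g (FreeLieAlgebra.of K) (fun _ => 0) fun _ _ => 0
  have hπ : ∀ f, π (inclY K G f) = f := fun f =>
    map_inclY_eq π LieHom.id (by simp [π]) f
  have hπz : ∀ j, π (gradedVar K j g) = 0 := fun j => gradedSubst_self _ _ _ hg j
  have hπt : ∀ w k, π w = 0 → π (lieTail w k) = 0 := by
    intro w k hw
    rw [lieTail_eq_lieWord, map_lieWord, hw, lieWord_zero]
  -- The retraction followed by the inclusion of L(Y) is a graded endomorphism, so it preserves
  -- graded identities; the block evaluation then yields an identity of UT_2.
  have hmem : ∀ f ∈ gradedIdentities (elementaryGrading K g 1),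
      π f ∈ identities K (UT 2 K) := by
    intro f hf
    refine inclY_mem_gradedIdentities hg ?_
    refine isTGIdeal_gradedIdentities
      (fun h k a b ha hb => lie_mem_elementaryGrading hg ha hb) ((inclY K G).comp π) ?_ f hf
    exact gradedSubst_mem (𝒜 := fun h : G => (freeComponent K h).comap (inclY K G).toLinearMap)
      _ _ _ (fun i => inclY_mem_freeComponent _) (fun i => zero_mem _) fun i h => zero_mem _
  let T : FreeLieAlgebra K (ℕ × G) →ₗ[K] FreeLieAlgebra K ℕ ⧸ identities K (UT 2 K) :=
    (LieSubmodule.Quotient.mk' (identities K (UT 2 K)) :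
      FreeLieAlgebra K ℕ →ₗ[K] FreeLieAlgebra K ℕ ⧸ identities K (UT 2 K)).comp π.toLinearMap
  have hT : ∀ f, T f = LieSubmodule.Quotient.mk (π f) := fun _ => rfl
  obtain ⟨T', hT'⟩ := exists_linearMap_quotient (gradedIdentities (elementaryGrading K g 1)) T
    fun x hx => (LieSubmodule.Quotient.mk_eq_zero _).2 (hmem x hx)
  have key := LinearIndependent.sumElim_of_comp (v := fun m : B =>
    (LieSubmodule.Quotient.mk (inclY K G (m : FreeLieAlgebra K ℕ)) :
        FreeLieAlgebra K (ℕ × G) ⧸ gradedIdentities (elementaryGrading K g 1))) T' ?_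
    (linearIndependent_typeOne_typeTwo hg hbasis) ?_
  · convert! key using 1
    funext q
    rcases q with m | q | q <;> rfl
  · convert! hbasis.1 using 1
    funext m
    rw [Function.comp_apply, hT', hT, hπ]
  · rintro (q | q)
    · rw [Sum.elim_inl, hT', hT, typeOne, hπt _ _ (hπz _)]
      rfl
    · rw [Sum.elim_inr, hT', hT, typeTwo, hπt _ _ (by rw [LieHom.map_lie, hπz, lie_zero])]
      rfl

/-- The free Lie algebra has a set of monomials that is a basis modulo a given ideal. -/
theorem exists_isBasisModulo (I : LieIdeal K (FreeLieAlgebra K ℕ)) :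
    ∃ B : Set (FreeLieAlgebra K ℕ), (∀ m ∈ B, ∃ n, m ∈ lengthComponent K n) ∧
      IsBasisModulo I (fun m : B => (m : FreeLieAlgebra K ℕ)) := by
  let M : Set (FreeLieAlgebra K ℕ) := {a | ∃ n, IsMonomialOfLength K n a}
  have hM : ∀ a, a ∈ Submodule.span K M := by
    let S : LieSubalgebra K (FreeLieAlgebra K ℕ) :=
      { Submodule.span K M with
        lie_mem' := fun {a b} ha hb => by
          change ⁅a, b⁆ ∈ Submodule.span K M
          change a ∈ Submodule.span K M at ha
          change b ∈ Submodule.span K M at hb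
          induction ha using Submodule.span_induction with
          | mem a ha =>
            induction hb using Submodule.span_induction with
            | mem b hb =>
              obtain ⟨m, hm⟩ := ha
              obtain ⟨n, hn⟩ := hb
              exact Submodule.subset_span ⟨m + n, IsMonomialOfLength.of_lie m n a b hm hn⟩
            | zero => rw [lie_zero]; exact zero_mem _
            | add b c _ _ hb hc => rw [lie_add]; exact add_mem hb hc
            | smul r b _ hb => rw [lie_smul]; exact Submodule.smul_mem _ r hb
          | zero => rw [zero_lie]; exact zero_mem _
          | add a c _ _ ha hc => rw [add_lie]; exact add_mem ha hc
          | smul r a _ ha => rw [smul_lie]; exact Submodule.smul_mem _ r ha }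
    exact FreeLieAlgebra.mem_of_forall_of_mem S fun i =>
      Submodule.subset_span ⟨1, IsMonomialOfLength.of_var i⟩
  let π : FreeLieAlgebra K ℕ →ₗ[K] FreeLieAlgebra K ℕ ⧸ I :=
    (LieSubmodule.Quotient.mk' I : FreeLieAlgebra K ℕ →ₗ[K] FreeLieAlgebra K ℕ ⧸ I)
  -- Monomials span, so a maximal set of monomials with independent images is a basis of the
  -- quotient.
  obtain ⟨B, hBM, -, hB', hB⟩ := exists_linearIndepOn_extension
    (K := K) (v := π) (s := ∅) (t := M) (linearIndepOn_empty K _) (Set.empty_subset _)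
  refine ⟨B, fun m hm => ?_, hB, ?_⟩
  · obtain ⟨n, hn⟩ := hBM hm
    exact ⟨n, Submodule.subset_span hn⟩
  · rw [eq_top_iff]
    rintro x -
    obtain ⟨f, rfl⟩ := LieSubmodule.Quotient.surjective_mk' I x
    have h : π f ∈ Submodule.map π (Submodule.span K M) := Submodule.mem_map_of_mem (hM f)
    rw [Submodule.map_span] at h
    have h' : π f ∈ Submodule.span K (π '' B) := Submodule.span_le.2 hB' h
    rwa [Set.image_eq_range] at h'

theorem eq_zero_of_mem_span_of_linearIndependent {L ι : Type*} [LieRing L] [LieAlgebra K L]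
    {I : LieIdeal K L} {v : ι → L}
    (hv : LinearIndependent K (fun i => (LieSubmodule.Quotient.mk (v i) : L ⧸ I))) {x : L}
    (hx : x ∈ Submodule.span K (Set.range v)) (hxI : x ∈ I) : x = 0 :=
  Submodule.disjoint_def.1 (Submodule.range_ker_disjoint
    (f := (LieSubmodule.Quotient.mk' I : L →ₗ[K] L ⧸ I)) hv) x hx
    ((LieSubmodule.Quotient.mk_eq_zero I).2 hxI)

theorem span_range_mk_eq_top {L ι : Type*} [LieRing L] [LieAlgebra K L]
    {I : LieIdeal K L} {v : ι → L}
    (hv : ∀ f, f ∈ Submodule.span K (Set.range v) ⊔ I.toSubmodule) :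
    Submodule.span K (Set.range fun i => (LieSubmodule.Quotient.mk (v i) : L ⧸ I)) = ⊤ := by
  rw [eq_top_iff]
  rintro x -
  obtain ⟨f, rfl⟩ := LieSubmodule.Quotient.surjective_mk' I x
  obtain ⟨a, ha, n, hn, rfl⟩ := Submodule.mem_sup.1 (hv f)
  have hn0 : LieSubmodule.Quotient.mk' I n = 0 := (LieSubmodule.Quotient.mk_eq_zero I).2 hn
  rw [map_add, hn0, add_zero]
  have := Submodule.mem_map_of_mem (f := (LieSubmodule.Quotient.mk' I : L →ₗ[K] L ⧸ I)) ha
  rw [Submodule.map_span, ← Set.range_comp] at this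
  exact this

end Independence

/-! ### Generators and basis together. -/

theorem mainTheorem4 {K : Type*} [Field K] [Infinite K] {G : Type*} [Group G]
    (g : G) (hg : g ≠ 1) :
    (let y : ℕ → FreeLieAlgebra K (ℕ × G) := fun i => gradedVar K i 1
     let z : ℕ → FreeLieAlgebra K (ℕ × G) := fun i => gradedVar K i g
     gradedIdentities (elementaryGrading K g 1) =
      tgIdealSpan
        ({f | ∃ l : G, l ≠ 1 ∧ l ≠ g ∧ f = gradedVar K 1 l} ∪
          {⁅z 1, z 2⁆,
           ⁅⁅y 1, y 2⁆, ⁅y 3, y 4⁆⁆,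
           ⁅⁅z 1, ⁅y 2, y 3⁆⁆, ⁅y 4, y 5⁆⁆})) ∧
    ∀ B : Set (FreeLieAlgebra K ℕ),
      (∀ m ∈ B, ∃ n, m ∈ lengthComponent K n) →
      IsBasisModulo (identities K (UT 2 K)) (fun m : B => (m : FreeLieAlgebra K ℕ)) →
      IsBasisModulo (gradedIdentities (elementaryGrading K g 1))
        (Sum.elim (fun m : B => inclY K G (m : FreeLieAlgebra K ℕ))
          (Sum.elim (typeOne K g) (typeTwo g B))) := by
  have hI := containsGradedRelations_tgIdealSpan (K := K) hg
  have hle := tgIdealSpan_gradedGenerators_le (K := K) hg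
  refine ⟨?_, fun B hB hbasis => ⟨linearIndependent_family hg hbasis, ?_⟩⟩
  · change gradedIdentities (elementaryGrading K g 1) = tgIdealSpan (gradedGenerators K g)
    refine le_antisymm (fun f hf => ?_) hle
    -- The equality of ideals does not mention B, so any homogeneous basis may serve as an auxiliary
    -- choice.
    obtain ⟨B, hB, hbasis⟩ := exists_isBasisModulo (identities K (UT 2 K))
    obtain ⟨x, hx, n, hn, rfl⟩ :=
      Submodule.mem_sup.1 (hI.mem_span_family_sup hg hle hB hbasis f)
    have hn' : n ∈ tgIdealSpan (gradedGenerators K g) := hn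
    have hx' : x ∈ gradedIdentities (elementaryGrading K g 1) := by
      simpa using sub_mem hf (hle hn')
    have hx0 := eq_zero_of_mem_span_of_linearIndependent
      (linearIndependent_family hg hbasis) hx hx'
    rwa [hx0, zero_add]
  · have hle' : (tgIdealSpan (gradedGenerators K g)).toSubmodule ≤
        (gradedIdentities (elementaryGrading K g 1)).toSubmodule := hle
    refine span_range_mk_eq_top fun f => ?_
    have hf := hI.mem_span_family_sup hg hle hB hbasis f
    exact (sup_le_sup_left hle' _ : _ ≤ _) hf
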